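/- **Setting.** All structures $\mathfrak A$ are finite, over a relational signature $\Sigma$. Besides its domain $A$, a structure has the numerical domain $A^{\le}=\{0,1,\dots,|A|\}$ with its natural order $\le$; variables are either domain variables (ranging over $A$) or numerical variables (ranging over $A^{\le}$). The type of a tuple is a word in $\{\mathrm{element},\mathrm{number}\}^*$, relation symbols and relation variables have types, and $A^{T}$ (or $A^{\vec x}$) is the set of tuples of type $T$ (or of the type of $\vec x$). A tuple $\vec\mu=(\mu_1,\dots,\mu_k)$ of numbers denotes $\mathrm{val}(\vec\mu)=\sum_{i=1}^k|A|^{k-i}\mu_i$; it *encodes* $m$ if $\mathrm{val}(\vec\mu)=m$ and $\mu_i<|A|$ for all $i\ge 2$. Each integer is encoded by at most one $k$-tuple. Fixed-point logic $\mathsf{FP}$ is here first-order logic over these two-sorted structures with inflationary fixed points (of relations of any type, with parameters) and counting of domain elements, i.e. all logics extend $\mathsf{FPC}$. *The operator $\mathsf{ord}$.* For a formula $\varphi(\vec p,\vec s,\vec t)$, possibly with further free variables, where $\vec s,\vec t$ have the same type $T$, let $G\le\mathrm{Sym}(A^T)$ be the group generated by all permutations $\sigma$ whose graph is $\{(\vec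 s,\vec t):\varphi(\vec a,\vec s,\vec t)\}$ for some $\vec a\in A^{\vec p}$. Then $(\mathsf{ord}_{\vec p.\vec s.\vec t}\,\varphi)$ is the relation of type $\mathrm{number}^{2|T|}$ that holds of $\vec\mu$ iff the bit of weight $2^{\mathrm{val}(\vec\mu)}$ in the binary expansion of $|G|$ is $1$. *The uniform operator $\mathsf{rk}$.* For a formula $\varphi(\vec x,\vec y,\vec\mu)$, possibly with further free variables, tuples $\vec\mu,\vec\pi$ of numerical variables of the same length $k$, and an output length $\ell\ge 0$ (for instance $\ell=\min\{|\vec x|,|\vec y|\}$), $(\mathsf{rk}_{\vec x.\vec y.\vec\mu}\,\varphi.\vec\pi)$ is the following relation of type $\mathrm{number}^\ell$, with the variables $\vec\pi$ free. Let $p=\mathrm{val}(\vec\pi)$. If $p$ is a prime with $p<|A|^{k}$ and if for all $\vec a\in A^{\vec x}$, $\vec b\in A^{\vec y}$ there is exactly one integer $m_{\vec a,\vec b}$ of the form $\mathrm{val}(\vec c)$ with $\varphi(\vec a,\vec b,\vec c)$, then it consists of the $\ell$-tuple (if any) that encodes $\mathsf{rank}_p(M)$, the dimension of the image of the linear map $\mathbb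 F_p^{A^{\vec x}}\to\mathbb F_p^{A^{\vec y}}$, $\vec u\mapsto\big(\sum_{\vec a}m_{\vec a,\vec b}\,u_{\vec a}\big)_{\vec b}$. Otherwise it is empty. $\mathsf{FP}+\mathsf{ord}$ and $\mathsf{FP}+\mathsf{rk}$ are the closures of $\mathsf{FP}$ under the respective operator (which may be nested and combined with all other constructs). For logics $\mathcal L,\mathcal L'$, $\mathcal L\le\mathcal L'$ means that every query $\mathfrak A\mapsto\varphi(\mathfrak A)$ (the set of assignments to the free variables that satisfy $\varphi$ in $\mathfrak A$) definable in $\mathcal L$ is definable in $\mathcal L'$. **Theorem.** 1. Every instance of the uniform rank operator is definable in $\mathsf{FP}+\mathsf{ord}$: for every signature $\Sigma$, all $\varphi\in(\mathsf{FP}+\mathsf{ord})[\Sigma]$, $\vec x,\vec y,\vec\mu,\vec\pi$ and $\ell$ as above, there is a formula $\psi\in(\mathsf{FP}+\mathsf{ord})[\Sigma]$ such that for every $\Sigma$-structure $\mathfrak A$ and every assignment $v$ to $\vec\pi$ and the other free variables, $$\psi(\mathfrak A,v)=(\mathsf{rk}_{\vec x.\vec y.\vec\mu}\,\varphi.\vec\pi)(\mathfrak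 A,v)\subseteq (A^{\le})^{\ell}.$$ 2. Consequently $\mathsf{FP}+\mathsf{rk}\le\mathsf{FP}+\mathsf{ord}$. -/

import Mathlib

namespace OrderLogic

/-! ### Types, signatures, finite structures and their numerical sort -/

/-- The two sorts: domain elements and numbers. -/
inductive Srt : Type
  | element
  | number

/-- A type: a finite word over `{element, number}`. -/
structure Ty : Type where
  len : ℕ
  sort : Fin len → Srt

/-- The word `number ^ k`. -/
abbrev Ty.num (k : ℕ) : Ty := ⟨k, fun _ => Srt.number⟩

/-- The word with the single letter `s`. -/
abbrev Ty.single (s : Srt) : Ty := ⟨1, fun _ => s⟩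

/-- The numerical domain `{0, 1, …, |A|}`. -/
abbrev Num (A : Type) [Fintype A] : Type := Fin (Fintype.card A + 1)

/-- The set over which a variable of sort `s` ranges. -/
def Carrier (A : Type) [Fintype A] : Srt → Type
  | Srt.element => A
  | Srt.number => Num A

instance (A : Type) [Fintype A] (s : Srt) : Fintype (Carrier A s) :=
  match s with
  | Srt.element => inferInstanceAs (Fintype A)
  | Srt.number => inferInstanceAs (Fintype (Num A))

/-- The set `A ^ T` of tuples of type `T`. In particular `A ^ (number ^ k)` is
`Fin k → Num A` by definition. -/
abbrev Tuple (A : Type) [Fintype A] (T : Ty) : Type := (i : Fin T.len) → Carrier A (T.sort i)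

/-- A relational signature; every relation symbol has a type. -/
structure Signature : Type 1 where
  Rel : Type
  type : Rel → Ty

/-- A finite structure over the signature `S` (the domain may be empty). -/
structure FinStr (S : Signature) : Type 1 where
  Dom : Type
  [fintypeDom : Fintype Dom]
  rel : (R : S.Rel) → Set (Tuple Dom (S.type R))

attribute [instance] FinStr.fintypeDom

/-! ### Integers encoded by tuples of numbers -/

/-- The integer `∑ |A| ^ (k - i) * μ_i` (for `i` from `1` to `k`) denoted by a `k`-tuple of
numbers. -/
def numVal {A : Type} [Fintype A] {k : ℕ} (μ : Fin k → Num A) : ℕ :=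
  ∑ i : Fin k, Fintype.card A ^ (k - 1 - (i : ℕ)) * (μ i : ℕ)

/-- `μ` is the tuple that encodes `m`: it denotes `m`, and no digit except possibly the leading
one equals `|A|`. Every `m < |A| ^ k` is encoded by its usual `k`-digit expansion in base `|A|`, and
`|A| ^ k` by `(|A|, 0, …, 0)`. -/
def Encodes {A : Type} [Fintype A] {k : ℕ} (μ : Fin k → Num A) (m : ℕ) : Prop :=
  numVal μ = m ∧ ∀ i : Fin k, 0 < (i : ℕ) → (μ i : ℕ) < Fintype.card A

/-! ### The three operations on relations: fixed point, group order, rank -/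

/-- The stages `X₀ = ∅`, `Xᵢ₊₁ = Xᵢ ∪ F(Xᵢ)` of the inflationary iteration of `F`. -/
def inflStage {B : Type} (F : Set B → Set B) : ℕ → Set B
  | 0 => ∅
  | i + 1 => inflStage F i ∪ F (inflStage F i)

/-- The inflationary fixed point of `F`, for a finite set `B`. -/
def inflFix {B : Type} (F : Set B → Set B) : Set B := ⋃ i, inflStage F i

/-- The group generated by all permutations of `B` whose graph is `R a` for some parameter `a`.
Parameters for which `R a` is not the graph of a permutation are ignored. -/
def genGroup {P B : Type} (R : P → B → B → Prop) : Subgroup (Equiv.Perm B) :=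
  Subgroup.closure {σ | ∃ a, ∀ s t, R a s t ↔ σ s = t}

/-- The numerical relation `ord`: it holds of `μ` iff the bit of weight `2 ^ numVal μ` in
the binary expansion of the order of the generated group is `1`. -/
def ordRel {A : Type} [Fintype A] {P T : Ty} (R : Tuple A P → Tuple A T → Tuple A T → Prop) :
    Set (Fin (2 * T.len) → Num A) :=
  {μ | (Nat.card (genGroup R)).testBit (numVal μ) = true}

/-- `R ⊆ I × J × ℕ` defines the matrix `M`: for all `a, b`, the number `M a b` is the unique `m`
with `R a b m`. -/
def DefinesMatrix {I J : Type} (R : I → J → ℕ → Prop) (M : I → J → ℕ) : Prop :=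
  ∀ a b m, R a b m ↔ m = M a b

/-- The rank over `𝔽_p` of an `I × J` matrix of natural numbers, that is the dimension of the image of
`𝔽_p ^ I → 𝔽_p ^ J`, `u ↦ (b ↦ ∑ a, M a b * u a)`. -/
noncomputable def rankMod {I J : Type} [Fintype I] (p : ℕ) (M : I → J → ℕ) : ℕ :=
  (Matrix.of fun (b : J) (a : I) => (M a b : ZMod p)).rank

/-- The numerical relation `rk`, where `π` denotes the characteristic `p`. If `p` is a prime below
`|A| ^ k` and `R` defines a matrix, it consists of the tuple that encodes the rank of that
matrix over `𝔽_p`; otherwise it is empty. -/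
def rkRel {A : Type} [Fintype A] {X Y : Ty} {k : ℕ} (l : ℕ)
    (R : Tuple A X → Tuple A Y → (Fin k → Num A) → Prop) (π : Fin k → Num A) :
    Set (Fin l → Num A) :=
  {ν | numVal π < Fintype.card A ^ k ∧ (numVal π).Prime ∧
    ∃ M : Tuple A X → Tuple A Y → ℕ,
      DefinesMatrix (fun a b m => ∃ c, numVal c = m ∧ R a b c) M ∧
      Encodes ν (rankMod (numVal π) M)}

/-! ### Contexts, assignments -/

/-- The variables that may be free in a formula: typed first-order variables and typed relation
variables. -/
structure Ctx : Type 1 where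
  Var : Type
  sort : Var → Srt
  RVar : Type
  rtype : RVar → Ty

namespace Ctx

/-- The context of a tuple of first-order variables of type `T`, without relation variables. -/
abbrev ofTy (T : Ty) : Ctx := ⟨Fin T.len, T.sort, Empty, Empty.elim⟩

/-- Add a block of new first-order variables of type `T`. -/
abbrev bind (Γ : Ctx) (T : Ty) : Ctx :=
  ⟨Γ.Var ⊕ Fin T.len, Sum.elim Γ.sort T.sort, Γ.RVar, Γ.rtype⟩

/-- Add one new relation variable of type `T`. -/
abbrev bindRel (Γ : Ctx) (T : Ty) : Ctx :=
  ⟨Γ.Var, Γ.sort, Option Γ.RVar, fun X => X.elim T Γ.rtype⟩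

/-- The first-order variables of sort `s`. -/
structure VarOf (Γ : Ctx) (s : Srt) : Type where
  var : Γ.Var
  sort_eq : Γ.sort var = s

/-- The tuples of first-order variables of type `T`. -/
abbrev Args (Γ : Ctx) (T : Ty) : Type := (i : Fin T.len) → Γ.VarOf (T.sort i)

end Ctx

/-- An assignment of values to the variables of a context. -/
structure Assignment (Γ : Ctx) (A : Type) [Fintype A] : Type where
  val : (x : Γ.Var) → Carrier A (Γ.sort x)
  rval : (X : Γ.RVar) → Set (Tuple A (Γ.rtype X))

namespace Assignment

variable {Γ : Ctx} {A : Type} [Fintype A]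

/-- The assignment of a tuple to the variables of `Ctx.ofTy T`. -/
def ofTuple {T : Ty} (a : Tuple A T) : Assignment (Ctx.ofTy T) A :=
  ⟨a, fun X => X.elim⟩

def bind (v : Assignment Γ A) {T : Ty} (a : Tuple A T) : Assignment (Γ.bind T) A where
  val
    | Sum.inl x => v.val x
    | Sum.inr i => a i
  rval := v.rval

def bindRel (v : Assignment Γ A) {T : Ty} (R : Set (Tuple A T)) :
    Assignment (Γ.bindRel T) A where
  val := v.val
  rval
    | none => R
    | some X => v.rval X

/-- The value of a variable of sort `s`. -/
def get (v : Assignment Γ A) {s : Srt} (x : Γ.VarOf s) : Carrier A s :=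
  x.sort_eq ▸ v.val x.var

/-- The value of a tuple of variables. -/
def gets (v : Assignment Γ A) {T : Ty} (x : Γ.Args T) : Tuple A T := fun i => v.get (x i)

end Assignment

/-! ### Formulas -/

/-- The operators by which fixed-point logic can be extended. -/
inductive Operator : Type
  | ord
  | rk

/-- The formulas, over the signature `S` and with free variables in a given context, of
fixed-point logic with the numerical sort and counting, extended by the operators in `L`.
* `ex T φ` is `∃ x⃗, φ` for a block of variables `x⃗` of type `T`.
* `ifp T φ x⃗` is `[ifp_{X, y⃗} φ](x⃗)`, with `X` and `y⃗` of type `T`.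
* `count φ ν` is `#y φ = ν`, with a domain variable `y`.
* `ord P T φ μ⃗` is `(ord_{p⃗.s⃗.t⃗} φ)(μ⃗)`, with `p⃗` of type `P`, and `s⃗` and `t⃗` of type `T`.
* `rk X Y k l φ π⃗ ν⃗` is `(rk_{x⃗.y⃗.μ⃗} φ . π⃗)(ν⃗)`, with `x⃗`, `y⃗`, `μ⃗`, `π⃗`, `ν⃗` of
  types `X`, `Y`, `number ^ k`, `number ^ k`, `number ^ l`. -/
inductive Formula (S : Signature) (L : Set Operator) : Ctx → Type 1
  | eq {Γ : Ctx} {s : Srt} (x y : Γ.VarOf s) : Formula S L Γ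
  | le {Γ : Ctx} (x y : Γ.VarOf Srt.number) : Formula S L Γ
  | rel {Γ : Ctx} (R : S.Rel) (x : Γ.Args (S.type R)) : Formula S L Γ
  | rvar {Γ : Ctx} (X : Γ.RVar) (x : Γ.Args (Γ.rtype X)) : Formula S L Γ
  | not {Γ : Ctx} (φ : Formula S L Γ) : Formula S L Γ
  | and {Γ : Ctx} (φ ψ : Formula S L Γ) : Formula S L Γ
  | ex {Γ : Ctx} (T : Ty) (φ : Formula S L (Γ.bind T)) : Formula S L Γ
  | ifp {Γ : Ctx} (T : Ty) (φ : Formula S L ((Γ.bind T).bindRel T)) (x : Γ.Args T) :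
      Formula S L Γ
  | count {Γ : Ctx} (φ : Formula S L (Γ.bind (Ty.single Srt.element)))
      (ν : Γ.VarOf Srt.number) : Formula S L Γ
  | ord {Γ : Ctx} (h : Operator.ord ∈ L) (P T : Ty)
      (φ : Formula S L (((Γ.bind P).bind T).bind T)) (μ : Γ.Args (Ty.num (2 * T.len))) :
      Formula S L Γ
  | rk {Γ : Ctx} (h : Operator.rk ∈ L) (X Y : Ty) (k l : ℕ)
      (φ : Formula S L (((Γ.bind X).bind Y).bind (Ty.num k)))
      (π : Γ.Args (Ty.num k)) (ν : Γ.Args (Ty.num l)) : Formula S L Γ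

/-- Satisfaction: `φ.Holds 𝔄 v` is `(𝔄, v) ⊨ φ`. -/
def Formula.Holds {S : Signature} {L : Set Operator} (𝔄 : FinStr S) :
    {Γ : Ctx} → Formula S L Γ → Assignment Γ 𝔄.Dom → Prop
  | _, .eq x y, v => v.get x = v.get y
  | _, .le x y, v => (show Num 𝔄.Dom from v.get x) ≤ (show Num 𝔄.Dom from v.get y)
  | _, .rel R x, v => v.gets x ∈ 𝔄.rel R
  | _, .rvar X x, v => v.gets x ∈ v.rval X
  | _, .not φ, v => ¬ φ.Holds 𝔄 v
  | _, .and φ ψ, v => φ.Holds 𝔄 v ∧ ψ.Holds 𝔄 v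
  | _, .ex _ φ, v => ∃ a, φ.Holds 𝔄 (v.bind a)
  | _, .ifp _ φ x, v => v.gets x ∈ inflFix fun R => {a | φ.Holds 𝔄 ((v.bind a).bindRel R)}
  | _, .count φ ν, v =>
      Set.ncard {a : 𝔄.Dom | φ.Holds 𝔄 (v.bind (T := Ty.single Srt.element) fun _ => a)} =
        ((show Num 𝔄.Dom from v.get ν) : ℕ)
  | _, .ord _ _ _ φ μ, v =>
      v.gets μ ∈ ordRel fun p s t => φ.Holds 𝔄 (((v.bind p).bind s).bind t)
  | _, .rk _ _ _ k l φ π ν, v =>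
      v.gets ν ∈ rkRel l
        (fun a b c => φ.Holds 𝔄 (((v.bind a).bind b).bind (T := Ty.num k) c)) (v.gets π)

/-- The logic `FP + ord`. -/
def FPord : Set Operator := {Operator.ord}

/-- The logic `FP + rk`. -/
def FPrk : Set Operator := {Operator.rk}

/-- The query `𝔄 ↦ φ(𝔄)` defined by a formula with a tuple of free variables of type `T`. -/
def Formula.query {S : Signature} {L : Set Operator} {T : Ty} (φ : Formula S L (Ctx.ofTy T))
    (𝔄 : FinStr S) : Set (Tuple 𝔄.Dom T) :=
  {a | φ.Holds 𝔄 (Assignment.ofTuple a)}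

/-- `L ≤ L'`: every query definable in `L` is definable in `L'`. -/
def LogicLE (L L' : Set Operator) : Prop :=
  ∀ (S : Signature) (T : Ty) (φ : Formula S L (Ctx.ofTy T)),
    ∃ ψ : Formula S L' (Ctx.ofTy T), ∀ 𝔄 : FinStr S, ψ.query 𝔄 = φ.query 𝔄

end OrderLogic

open OrderLogic

/-! Let `M` be a matrix over `𝔽_p` with index sets `I` and `J`. Each `a ∈ I` gives the permutation
`(j, κ, z) ↦ (j, κ, z + M a j)` of `J × K × ℤ/p`. If `K` is nonempty, `u ↦ ((j, κ, z) ↦ (j, κ, z + u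
j))` embeds `𝔽_p ^ J` faithfully, so the generated group is isomorphic to the additive group spanned
by the vectors `M a`. Over a prime field this span is a subspace, hence the order is `p ^ rank M`
(`card_genGroup_of_shift`). Residues are coded by base-`|A|` digit tuples, which makes the action
definable on tuples of a suitable type (`card_genGroup_shiftRel`).

The exponent is read off by comparison. A diagonal 0/1 matrix supported on `D` has rank `|D|`, so
`rank M = |D|` holds iff two such groups have equal order. If both act on tuples of the same type,
and that type is long enough for `ord` to see all bits of both orders, this is equality of two `ord`
relations (`ordRel_shiftRel_eq_iff`). The idle factor `K` provides the padding that makes the types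
agree.

The arithmetic is obtained from the same device. A number is represented as the cardinality of a
definable set of number tuples (`DefinableNat`). The case `p = 2` with diagonal matrices expresses
equality of cardinalities (`ncard_eq_ncard`); sums and products are tagged unions and
concatenations, and order, divisibility, congruence and primality follow by bounded quantification.
Thus the construction around a given formula uses only first-order logic and `ord`. The rank is then
compared with the number denoted by the output tuple (`Definable.rankMod_eq`, `Definable.rkRel`).

Domains with fewer than two elements are harmless: no prime lies below `|A| ^ k ≤ 1`, so the rank
relation is empty there. The second claim follows by induction on formulas. -/

namespace OrderLogic

/-! ### Renaming of first-order variables -/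

/-- A map between sets of first-order variables that preserves sorts. -/
structure VarMap {V V' : Type} (s : V → Srt) (s' : V' → Srt) where
  toFun : V → V'
  sort_eq : ∀ x, s' (toFun x) = s x

namespace VarMap

variable {V V' : Type} {s : V → Srt} {s' : V' → Srt} {R : Type} {rt : R → Ty}

/-- The extension of a map of variables by the identity on a block of new variables. -/
def bind (ρ : VarMap s s') (T : Ty) : VarMap (Sum.elim s T.sort) (Sum.elim s' T.sort) where
  toFun := Sum.map ρ.toFun id
  sort_eq
    | Sum.inl x => ρ.sort_eq x
    | Sum.inr _ => rfl

/-- The image of a variable of a given sort. -/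
def mapVar (ρ : VarMap s s') {u : Srt} (x : Ctx.VarOf ⟨V, s, R, rt⟩ u) :
    Ctx.VarOf ⟨V', s', R, rt⟩ u :=
  ⟨ρ.toFun x.var, (ρ.sort_eq x.var).trans x.sort_eq⟩

end VarMap

namespace Assignment

variable {V V' : Type} {s : V → Srt} {s' : V' → Srt} {R : Type} {rt : R → Ty}
  {A : Type} [Fintype A]

/-- The assignment obtained by precomposition with a map of variables. -/
def pull (ρ : VarMap s s') (v : Assignment ⟨V', s', R, rt⟩ A) : Assignment ⟨V, s, R, rt⟩ A where
  val x := (ρ.sort_eq x ▸ v.val (ρ.toFun x) : Carrier A (s x))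
  rval := v.rval

theorem pull_bind (ρ : VarMap s s') (v : Assignment ⟨V', s', R, rt⟩ A) {T : Ty} (a : Tuple A T) :
    (v.bind a).pull (ρ.bind T) = (v.pull ρ).bind a := by
  simp only [pull, bind, mk.injEq, and_true]
  funext x
  cases x <;> rfl

theorem pull_bindRel (ρ : VarMap s s') (v : Assignment ⟨V', s', R, rt⟩ A) {T : Ty}
    (X : Set (Tuple A T)) : (v.bindRel X).pull ρ = (v.pull ρ).bindRel X := by
  simp only [pull, bindRel, mk.injEq, true_and]
  funext x
  cases x <;> rfl

theorem cast_cast_carrier {a b c : Srt} (h : a = b) (h' : b = c) (x : Carrier A a) :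
    (h' ▸ (h ▸ x : Carrier A b) : Carrier A c) = (h.trans h') ▸ x := by
  subst h; subst h'; rfl

theorem get_pull (ρ : VarMap s s') (v : Assignment ⟨V', s', R, rt⟩ A) {u : Srt}
    (x : Ctx.VarOf ⟨V, s, R, rt⟩ u) : (v.pull ρ).get x = v.get (ρ.mapVar x) :=
  cast_cast_carrier _ _ _

theorem gets_pull (ρ : VarMap s s') (v : Assignment ⟨V', s', R, rt⟩ A) {T : Ty}
    (x : Ctx.Args ⟨V, s, R, rt⟩ T) : (v.pull ρ).gets x = v.gets fun i => ρ.mapVar (x i) :=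
  funext fun i => get_pull ρ v (x i)

variable {Γ : Ctx} {T : Ty}

/-- The restriction of an assignment to the old variables. -/
def old (w : Assignment (Γ.bind T) A) : Assignment Γ A :=
  ⟨fun x => w.val (Sum.inl x), w.rval⟩

/-- The values of the new variables. -/
def new (w : Assignment (Γ.bind T) A) : Tuple A T := fun i => w.val (Sum.inr i)

end Assignment

/-- A formula is tied to its context, so weakening by new quantified blocks and substitution of
variables for arguments both need a new formula. Both are renamings that fix the relation variables.
-/
theorem Formula.exists_rename {S : Signature} {L : Set Operator} {Γ : Ctx} (φ : Formula S L Γ) :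
    ∀ {V' : Type} {s' : V' → Srt} (ρ : VarMap Γ.sort s'),
      ∃ ψ : Formula S L ⟨V', s', Γ.RVar, Γ.rtype⟩, ∀ (𝔄 : FinStr S)
        (v : Assignment ⟨V', s', Γ.RVar, Γ.rtype⟩ 𝔄.Dom),
        ψ.Holds 𝔄 v ↔ φ.Holds 𝔄 (v.pull ρ) := by
  induction φ with
  | eq x y =>
    intro V' s' ρ
    exact ⟨.eq (ρ.mapVar x) (ρ.mapVar y), fun 𝔄 v => by
      simp only [Formula.Holds]; rw [← Assignment.get_pull, ← Assignment.get_pull]⟩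
  | le x y =>
    intro V' s' ρ
    exact ⟨.le (ρ.mapVar x) (ρ.mapVar y), fun 𝔄 v => by
      simp only [Formula.Holds]; rw [← Assignment.get_pull, ← Assignment.get_pull]⟩
  | rel R x =>
    intro V' s' ρ
    exact ⟨.rel R fun i => ρ.mapVar (x i), fun 𝔄 v => by
      simp only [Formula.Holds]; rw [← Assignment.gets_pull]⟩
  | @rvar Γ X x =>
    intro V' s' ρ
    exact ⟨.rvar (Γ := ⟨V', s', Γ.RVar, Γ.rtype⟩) X fun i => ρ.mapVar (x i), fun 𝔄 v => by
      simp only [Formula.Holds]; rw [← Assignment.gets_pull]; rfl⟩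
  | not φ ih =>
    intro V' s' ρ
    obtain ⟨ψ, h⟩ := ih ρ
    exact ⟨.not ψ, fun 𝔄 v => by simp only [Formula.Holds, h]⟩
  | and φ φ' ih ih' =>
    intro V' s' ρ
    obtain ⟨ψ, h⟩ := ih ρ
    obtain ⟨ψ', h'⟩ := ih' ρ
    exact ⟨.and ψ ψ', fun 𝔄 v => by simp only [Formula.Holds, h, h']⟩
  | ex T φ ih =>
    intro V' s' ρ
    obtain ⟨ψ, h⟩ := ih (ρ.bind T)
    refine ⟨.ex T ψ, fun 𝔄 v => ?_⟩
    simp only [Formula.Holds]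
    exact exists_congr fun a => by rw [← Assignment.pull_bind]; exact h 𝔄 _
  | @ifp Γ' T φ x ih =>
    intro V' s' ρ
    obtain ⟨ψ, h⟩ := ih (ρ.bind T)
    refine ⟨.ifp T ψ fun i => ρ.mapVar (x i), fun 𝔄 v => ?_⟩
    simp only [Formula.Holds]
    rw [← Assignment.gets_pull]
    have : (fun R : Set (Tuple 𝔄.Dom T) => {a | ψ.Holds 𝔄 ((v.bind a).bindRel R)}) =
        fun R => {a | φ.Holds 𝔄 (((v.pull ρ).bind a).bindRel R)} := by
      funext R
      ext a
      exact (h 𝔄 ((v.bind a).bindRel R)).trans (iff_of_eq (congrArg (φ.Holds 𝔄)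
        ((Assignment.pull_bindRel (ρ.bind T) (v.bind a) R).trans
          (congrArg (fun u : Assignment (Γ'.bind T) 𝔄.Dom => u.bindRel R)
            (Assignment.pull_bind ρ v a)))))
    rw [this]
  | count φ ν ih =>
    intro V' s' ρ
    obtain ⟨ψ, h⟩ := ih (ρ.bind _)
    refine ⟨.count ψ (ρ.mapVar ν), fun 𝔄 v => ?_⟩
    simp only [Formula.Holds]
    rw [← Assignment.get_pull]
    have : {a : 𝔄.Dom | ψ.Holds 𝔄 (v.bind (T := Ty.single Srt.element) fun _ => a)} =
        {a : 𝔄.Dom | φ.Holds 𝔄 ((v.pull ρ).bind (T := Ty.single Srt.element) fun _ => a)} := by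
      ext a
      exact (h 𝔄 _).trans (iff_of_eq (congrArg (φ.Holds 𝔄)
        (Assignment.pull_bind (T := Ty.single Srt.element) ρ v fun _ => a)))
    rw [this]
  | ord hL P T φ μ ih =>
    intro V' s' ρ
    obtain ⟨ψ, h⟩ := ih (((ρ.bind P).bind T).bind T)
    refine ⟨.ord hL P T ψ fun i => ρ.mapVar (μ i), fun 𝔄 v => ?_⟩
    simp only [Formula.Holds]
    rw [← Assignment.gets_pull]
    have : (fun p s t => ψ.Holds 𝔄 (((v.bind p).bind s).bind t)) =
        fun p s t => φ.Holds 𝔄 ((((v.pull ρ).bind p).bind s).bind t) := by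
      funext p s t
      rw [← Assignment.pull_bind, ← Assignment.pull_bind, ← Assignment.pull_bind]
      exact propext (h 𝔄 _)
    rw [this]
  | rk hL X Y k l φ π ν ih =>
    intro V' s' ρ
    obtain ⟨ψ, h⟩ := ih (((ρ.bind X).bind Y).bind (Ty.num k))
    refine ⟨.rk hL X Y k l ψ (fun i => ρ.mapVar (π i)) fun i => ρ.mapVar (ν i), fun 𝔄 v => ?_⟩
    simp only [Formula.Holds]
    rw [← Assignment.gets_pull, ← Assignment.gets_pull]
    have : (fun a b c => ψ.Holds 𝔄 (((v.bind a).bind b).bind (T := Ty.num k) c)) =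
        fun a b c => φ.Holds 𝔄 ((((v.pull ρ).bind a).bind b).bind (T := Ty.num k) c) := by
      funext p s t
      rw [← Assignment.pull_bind, ← Assignment.pull_bind, ← Assignment.pull_bind]
      exact propext (h 𝔄 _)
    exact iff_of_eq (congrArg (fun R => (v.pull ρ).gets ν ∈ rkRel l R ((v.pull ρ).gets π)) this)

/-! ### Definable predicates -/

section Definable

variable {S : Signature} {Γ : Ctx} {s : Srt} {T : Ty}

/-- The value `f` of sort `s` is that of a variable. -/
def IsVar (f : (𝔄 : FinStr S) → Assignment Γ 𝔄.Dom → Carrier 𝔄.Dom s) : Prop :=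
  ∃ x : Γ.VarOf s, ∀ 𝔄 v, f 𝔄 v = v.get x

/-- The tuple `f` of type `T` is that of the values of a tuple of variables. -/
def IsArgs (f : (𝔄 : FinStr S) → Assignment Γ 𝔄.Dom → Tuple 𝔄.Dom T) : Prop :=
  ∀ i, IsVar fun 𝔄 v => f 𝔄 v i

/-- `F` is the precomposition with a map of first-order variables. -/
def IsPull {V V' : Type} {s : V → Srt} {s' : V' → Srt} {R : Type} {rt : R → Ty}
    (F : (𝔄 : FinStr S) → Assignment ⟨V', s', R, rt⟩ 𝔄.Dom → Assignment ⟨V, s, R, rt⟩ 𝔄.Dom) :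
    Prop :=
  ∃ ρ : VarMap s s', ∀ 𝔄 v, F 𝔄 v = v.pull ρ

/-- The predicate `P` is defined by a formula of `FP + ord`, on structures with at least two
elements. -/
def Definable (P : (𝔄 : FinStr S) → Assignment Γ 𝔄.Dom → Prop) : Prop :=
  ∃ ψ : Formula S FPord Γ, ∀ 𝔄 : FinStr S, 2 ≤ Fintype.card 𝔄.Dom → ∀ v, ψ.Holds 𝔄 v ↔ P 𝔄 v

theorem IsArgs.exists_args {f : (𝔄 : FinStr S) → Assignment Γ 𝔄.Dom → Tuple 𝔄.Dom T}
    (hf : IsArgs f) : ∃ x : Γ.Args T, ∀ 𝔄 v, f 𝔄 v = v.gets x := by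
  choose x hx using hf
  exact ⟨x, fun 𝔄 v => funext fun i => hx i 𝔄 v⟩

theorem isVar_get (x : Γ.VarOf s) : IsVar (S := S) fun _ v => v.get x := ⟨x, fun _ _ => rfl⟩

theorem isArgs_gets (x : Γ.Args T) : IsArgs (S := S) fun _ v => v.gets x := fun i => isVar_get (x i)

theorem isVar_new (i : Fin T.len) :
    IsVar (S := S) (fun _ (w : Assignment (Γ.bind T) _) => w.new i) :=
  ⟨⟨Sum.inr i, rfl⟩, fun _ _ => rfl⟩

theorem isArgs_new : IsArgs (S := S) (fun _ (w : Assignment (Γ.bind T) _) => w.new) := isVar_new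

theorem IsVar.old {f : (𝔄 : FinStr S) → Assignment Γ 𝔄.Dom → Carrier 𝔄.Dom s} (hf : IsVar f) :
    IsVar (fun 𝔄 (w : Assignment (Γ.bind T) 𝔄.Dom) => f 𝔄 w.old) := by
  obtain ⟨x, hx⟩ := hf
  exact ⟨⟨Sum.inl x.var, x.sort_eq⟩, fun 𝔄 w => hx 𝔄 w.old⟩

theorem IsArgs.old {U : Ty} {f : (𝔄 : FinStr S) → Assignment Γ 𝔄.Dom → Tuple 𝔄.Dom U}
    (hf : IsArgs f) : IsArgs (fun 𝔄 (w : Assignment (Γ.bind T) 𝔄.Dom) => f 𝔄 w.old) :=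
  fun i => (hf i).old

theorem isPull_id : IsPull (S := S) (fun _ (v : Assignment Γ _) => v) :=
  ⟨⟨id, fun _ => rfl⟩, fun _ _ => rfl⟩

theorem IsPull.old {V : Type} {s : V → Srt}
    {F : (𝔄 : FinStr S) → Assignment Γ 𝔄.Dom → Assignment ⟨V, s, Γ.RVar, Γ.rtype⟩ 𝔄.Dom}
    (hF : IsPull F) : IsPull (fun 𝔄 (w : Assignment (Γ.bind T) 𝔄.Dom) => F 𝔄 w.old) := by
  obtain ⟨ρ, h⟩ := hF
  exact ⟨⟨fun x => Sum.inl (ρ.toFun x), ρ.sort_eq⟩, fun 𝔄 w => h 𝔄 w.old⟩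

theorem IsPull.bind {V : Type} {s : V → Srt}
    {F : (𝔄 : FinStr S) → Assignment Γ 𝔄.Dom → Assignment ⟨V, s, Γ.RVar, Γ.rtype⟩ 𝔄.Dom}
    (hF : IsPull F) {a : (𝔄 : FinStr S) → Assignment Γ 𝔄.Dom → Tuple 𝔄.Dom T} (ha : IsArgs a) :
    IsPull (fun 𝔄 v => (F 𝔄 v).bind (a 𝔄 v)) := by
  obtain ⟨ρ, h⟩ := hF
  obtain ⟨x, hx⟩ := ha.exists_args
  refine ⟨⟨Sum.elim ρ.toFun fun i => (x i).var, ?_⟩, fun 𝔄 v => ?_⟩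
  · rintro (y | i)
    · exact ρ.sort_eq y
    · exact (x i).sort_eq
  · simp only [h, hx, Assignment.pull, Assignment.bind, Assignment.mk.injEq, and_true]
    funext y
    cases y <;> rfl

namespace Definable

variable {P Q : (𝔄 : FinStr S) → Assignment Γ 𝔄.Dom → Prop}

theorem of_formula (φ : Formula S FPord Γ) : Definable fun 𝔄 v => φ.Holds 𝔄 v :=
  ⟨φ, fun _ _ _ => Iff.rfl⟩

theorem congr (hP : Definable P)
    (h : ∀ 𝔄 : FinStr S, 2 ≤ Fintype.card 𝔄.Dom → ∀ v, Q 𝔄 v ↔ P 𝔄 v) : Definable Q := by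
  obtain ⟨ψ, hψ⟩ := hP
  exact ⟨ψ, fun 𝔄 hA v => (hψ 𝔄 hA v).trans (h 𝔄 hA v).symm⟩

/-- This is how a definability hypothesis about one context is reused in another: weakening is
`IsPull.old`, and plugging in argument tuples is `IsPull.bind`. -/
theorem comp (hP : Definable P) {V' : Type} {s' : V' → Srt}
    {F : (𝔄 : FinStr S) → Assignment ⟨V', s', Γ.RVar, Γ.rtype⟩ 𝔄.Dom → Assignment Γ 𝔄.Dom}
    (hF : IsPull F) : Definable fun 𝔄 v => P 𝔄 (F 𝔄 v) := by
  obtain ⟨φ, hφ⟩ := hP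
  obtain ⟨ρ, hρ⟩ := hF
  obtain ⟨ψ, hψ⟩ := φ.exists_rename ρ
  exact ⟨ψ, fun 𝔄 hA v => by
    simp only [hρ]; exact (hψ 𝔄 v).trans (hφ 𝔄 hA _)⟩

theorem old (hP : Definable P) :
    Definable (fun 𝔄 (w : Assignment (Γ.bind T) 𝔄.Dom) => P 𝔄 w.old) :=
  hP.comp (F := fun 𝔄 (w : Assignment (Γ.bind T) 𝔄.Dom) => w.old) (isPull_id (Γ := Γ)).old

theorem not (hP : Definable P) : Definable fun 𝔄 v => ¬ P 𝔄 v := by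
  obtain ⟨φ, hφ⟩ := hP
  exact ⟨.not φ, fun 𝔄 hA v => by simp only [Formula.Holds, hφ 𝔄 hA]⟩

theorem and (hP : Definable P) (hQ : Definable Q) : Definable fun 𝔄 v => P 𝔄 v ∧ Q 𝔄 v := by
  obtain ⟨φ, hφ⟩ := hP
  obtain ⟨ψ, hψ⟩ := hQ
  exact ⟨.and φ ψ, fun 𝔄 hA v => by simp only [Formula.Holds, hφ 𝔄 hA, hψ 𝔄 hA]⟩

theorem or (hP : Definable P) (hQ : Definable Q) : Definable fun 𝔄 v => P 𝔄 v ∨ Q 𝔄 v :=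
  (hP.not.and hQ.not).not.congr fun _ _ _ => by tauto

theorem imp (hP : Definable P) (hQ : Definable Q) : Definable fun 𝔄 v => P 𝔄 v → Q 𝔄 v :=
  (hP.and hQ.not).not.congr fun _ _ _ => by tauto

theorem iff (hP : Definable P) (hQ : Definable Q) : Definable fun 𝔄 v => P 𝔄 v ↔ Q 𝔄 v :=
  ((hP.imp hQ).and (hQ.imp hP)).congr fun _ _ _ => by tauto

theorem ex {P : (𝔄 : FinStr S) → Assignment Γ 𝔄.Dom → Tuple 𝔄.Dom T → Prop}
    (hP : Definable fun 𝔄 (w : Assignment (Γ.bind T) 𝔄.Dom) => P 𝔄 w.old w.new) :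
    Definable fun 𝔄 v => ∃ a, P 𝔄 v a := by
  obtain ⟨φ, hφ⟩ := hP
  exact ⟨.ex T φ, fun 𝔄 hA v => by
    simp only [Formula.Holds, hφ 𝔄 hA]; exact Iff.rfl⟩

theorem all {P : (𝔄 : FinStr S) → Assignment Γ 𝔄.Dom → Tuple 𝔄.Dom T → Prop}
    (hP : Definable fun 𝔄 (w : Assignment (Γ.bind T) 𝔄.Dom) => P 𝔄 w.old w.new) :
    Definable fun 𝔄 v => ∀ a, P 𝔄 v a :=
  (ex (P := fun 𝔄 v a => ¬ P 𝔄 v a) hP.not).not.congr fun _ _ _ => by simp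

theorem false : Definable (S := S) (Γ := Γ) fun _ _ => False := by
  -- There is no atomic falsity and the context may have no variable; a quantified numerical
  -- variable supplies one.
  have : Definable (S := S) (Γ := Γ.bind (Ty.num 1)) fun _ w => ¬ w.new = w.new :=
    ⟨.not (.eq ⟨Sum.inr 0, rfl⟩ ⟨Sum.inr 0, rfl⟩), fun 𝔄 _ v => by simp [Formula.Holds]⟩
  exact (ex (T := Ty.num 1) (P := fun _ _ a => ¬ a = a) this).congr fun _ _ _ => by simp

theorem true : Definable (S := S) (Γ := Γ) fun _ _ => True :=
  false.not.congr fun _ _ _ => by simp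

theorem forall_fin {n : ℕ} {P : Fin n → (𝔄 : FinStr S) → Assignment Γ 𝔄.Dom → Prop}
    (hP : ∀ i, Definable (P i)) : Definable fun 𝔄 v => ∀ i, P i 𝔄 v := by
  induction n with
  | zero => exact true.congr fun _ _ _ => by simp
  | succ n ih =>
    exact ((hP 0).and (ih fun i => hP i.succ)).congr fun _ _ _ => by rw [Fin.forall_fin_succ]

theorem const (p : Prop) : Definable (S := S) (Γ := Γ) fun _ _ => p := by
  by_cases h : p
  · exact true.congr fun _ _ _ => by simp [h]
  · exact false.congr fun _ _ _ => by simp [h]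

theorem eq {f g : (𝔄 : FinStr S) → Assignment Γ 𝔄.Dom → Carrier 𝔄.Dom s} (hf : IsVar f)
    (hg : IsVar g) : Definable fun 𝔄 v => f 𝔄 v = g 𝔄 v := by
  obtain ⟨x, hx⟩ := hf
  obtain ⟨y, hy⟩ := hg
  exact ⟨.eq x y, fun 𝔄 _ v => by simp only [Formula.Holds, hx, hy]⟩

theorem eq_tuple {f g : (𝔄 : FinStr S) → Assignment Γ 𝔄.Dom → Tuple 𝔄.Dom T} (hf : IsArgs f)
    (hg : IsArgs g) : Definable fun 𝔄 v => f 𝔄 v = g 𝔄 v :=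
  (forall_fin fun i => eq (hf i) (hg i)).congr fun _ _ _ => funext_iff

theorem lt {f g : (𝔄 : FinStr S) → Assignment Γ 𝔄.Dom → Num 𝔄.Dom}
    (hf : IsVar (s := Srt.number) f) (hg : IsVar (s := Srt.number) g) :
    Definable fun 𝔄 v => f 𝔄 v < g 𝔄 v := by
  obtain ⟨x, hx⟩ := hf
  obtain ⟨y, hy⟩ := hg
  exact ⟨.not (.le y x), fun 𝔄 _ v => by
    simp only [Formula.Holds, hx, hy]; exact not_le⟩

/-- Equality of two group orders, as far as it is visible to the operator `ord`. -/
theorem ordRel_eq {U U' : Ty}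
    {R : (𝔄 : FinStr S) → Assignment Γ 𝔄.Dom → Tuple 𝔄.Dom U → Tuple 𝔄.Dom T → Tuple 𝔄.Dom T → Prop}
    {R' : (𝔄 : FinStr S) → Assignment Γ 𝔄.Dom → Tuple 𝔄.Dom U' → Tuple 𝔄.Dom T → Tuple 𝔄.Dom T → Prop}
    (hR : Definable fun 𝔄 (w : Assignment (((Γ.bind U).bind T).bind T) 𝔄.Dom) =>
      R 𝔄 w.old.old.old w.old.old.new w.old.new w.new)
    (hR' : Definable fun 𝔄 (w : Assignment (((Γ.bind U').bind T).bind T) 𝔄.Dom) =>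
      R' 𝔄 w.old.old.old w.old.old.new w.old.new w.new) :
    Definable fun 𝔄 v => ordRel (R 𝔄 v) = ordRel (R' 𝔄 v) := by
  have key : ∀ {U : Ty}
      {R : (𝔄 : FinStr S) → Assignment Γ 𝔄.Dom → Tuple 𝔄.Dom U → Tuple 𝔄.Dom T →
        Tuple 𝔄.Dom T → Prop},
      (Definable fun 𝔄 (w : Assignment (((Γ.bind U).bind T).bind T) 𝔄.Dom) =>
        R 𝔄 w.old.old.old w.old.old.new w.old.new w.new) →
      Definable fun 𝔄 (w : Assignment (Γ.bind (Ty.num (2 * T.len))) 𝔄.Dom) =>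
        w.new ∈ ordRel (R 𝔄 w.old) := by
    intro U R hR
    -- The block of bit positions is inserted below the three blocks bound by `ord`, so that `ord`
    -- can be evaluated at these positions.
    obtain ⟨φ, hφ⟩ := hR.comp (((isPull_id.old (Γ := Γ) (T := Ty.num (2 * T.len))).old.old.old.bind
      isArgs_new.old.old).bind isArgs_new.old |>.bind isArgs_new)
    refine ⟨.ord rfl U T φ fun i => ⟨Sum.inr i, rfl⟩, fun 𝔄 hA w => ?_⟩
    simp only [Formula.Holds, hφ 𝔄 hA]
    exact Iff.rfl
  exact (all (T := Ty.num (2 * T.len)) (P := fun 𝔄 v μ => μ ∈ ordRel (R 𝔄 v) ↔ μ ∈ ordRel (R' 𝔄 v))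
    ((key hR).iff (key hR'))).congr fun _ _ _ => Set.ext_iff

end Definable

end Definable

/-! ### The order of a group of shifts -/

section ShiftGroup

variable {P J K B : Type} {p : ℕ}

/-- The permutation of `J × K × ℤ/p` that adds `u j` to the last component. -/
def shiftPerm (J K : Type) (p : ℕ) :
    Multiplicative (J → ZMod p) →* Equiv.Perm (J × K × ZMod p) where
  toFun u :=
    { toFun := fun x => (x.1, x.2.1, x.2.2 + u.toAdd x.1)
      invFun := fun x => (x.1, x.2.1, x.2.2 - u.toAdd x.1)
      left_inv := fun x => by simp
      right_inv := fun x => by simp }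
  map_one' := by ext x <;> simp
  map_mul' u v := by ext x <;> simp [add_left_comm, add_comm]

/-- The image of `(j, k, 0)` reveals `u j`; the factor `K` only has to contain one point. -/
theorem shiftPerm_injective [Nonempty K] : Function.Injective (shiftPerm J K p) := by
  intro u v h
  obtain ⟨k⟩ := ‹Nonempty K›
  apply Multiplicative.toAdd.injective
  funext j
  simpa [shiftPerm] using congrArg (fun σ : Equiv.Perm (J × K × ZMod p) => (σ (j, k, 0)).2.2) h

/-- An additive subgroup of an `𝔽_p`-space is already a subspace, so the generated group is the
column space of the matrix that defines `rankMod`. -/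
theorem card_closure_range_eq_pow_rankMod [Fintype P] [Finite J] [Fact p.Prime]
    (M : P → J → ℕ) :
    Nat.card (AddSubgroup.closure (Set.range fun a j => (M a j : ZMod p))) =
      p ^ rankMod p M := by
  have := Fintype.ofFinite J
  have h1 : AddSubgroup.toZModSubmodule p
      (AddSubgroup.closure (Set.range fun a j => (M a j : ZMod p))) =
      Submodule.span (ZMod p) (Set.range fun a j => (M a j : ZMod p)) := by
    apply le_antisymm
    · intro x hx
      have : AddSubgroup.closure (Set.range fun a j => (M a j : ZMod p)) ≤
          (Submodule.span (ZMod p) (Set.range fun a j => (M a j : ZMod p))).toAddSubgroup :=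
        (AddSubgroup.closure_le _).2 Submodule.subset_span
      exact this hx
    · exact Submodule.span_le.2 AddSubgroup.subset_closure
  have h2 : Nat.card (AddSubgroup.closure (Set.range fun a j => (M a j : ZMod p))) =
      Nat.card (Submodule.span (ZMod p) (Set.range fun a j => (M a j : ZMod p))) := by
    rw [← h1]; rfl
  rw [h2, Module.natCard_eq_pow_finrank (K := ZMod p), Nat.card_zmod, rankMod,
    Matrix.rank_eq_finrank_span_cols]
  rfl

/-- Extending permutations by the identity outside the range of `Ψ` is an injective homomorphism.
The generated group is therefore an isomorphic copy of the span of the vectors `M a`. -/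
theorem card_genGroup_of_shift [Fintype P] [Finite J] [Nonempty K] [Fact p.Prime]
    (M : P → J → ℕ) (Ψ : J × K × ZMod p ↪ B) (R : P → B → B → Prop)
    (h₁ : ∀ a j k z t, R a (Ψ (j, k, z)) t ↔ Ψ (j, k, z + M a j) = t)
    (h₂ : ∀ a s t, s ∉ Set.range Ψ → (R a s t ↔ s = t)) :
    Nat.card (genGroup R) = p ^ rankMod p M := by
  let Φ : Multiplicative (J → ZMod p) →* Equiv.Perm B :=
    (Equiv.Perm.viaEmbeddingHom Ψ).comp (shiftPerm J K p)
  have hΦ : Function.Injective Φ :=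
    (Equiv.Perm.viaEmbeddingHom_injective Ψ).comp shiftPerm_injective
  let u : P → Multiplicative (J → ZMod p) := fun a => Multiplicative.ofAdd fun j => (M a j : ZMod p)
  have hR : ∀ a s t, R a s t ↔ Φ (u a) s = t := by
    intro a s t
    by_cases hs : s ∈ Set.range Ψ
    · obtain ⟨⟨j, k, z⟩, rfl⟩ := hs
      rw [h₁]
      have : Φ (u a) (Ψ (j, k, z)) = Ψ (j, k, z + M a j) := by
        simp only [Φ, MonoidHom.comp_apply, Equiv.Perm.viaEmbeddingHom_apply,
          Equiv.Perm.viaEmbedding_apply]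
        rfl
      rw [this]
    · rw [h₂ a s t hs]
      have : Φ (u a) s = s := by
        simp only [Φ, MonoidHom.comp_apply, Equiv.Perm.viaEmbeddingHom_apply]
        exact Equiv.Perm.viaEmbedding_apply_of_notMem _ _ _ hs
      rw [this]
  -- Every `R a` is the graph of a permutation, so no parameter is discarded.
  have hset : {σ : Equiv.Perm B | ∃ a, ∀ s t, R a s t ↔ σ s = t} = Φ '' Set.range u := by
    ext σ
    constructor
    · rintro ⟨a, ha⟩
      refine ⟨u a, ⟨a, rfl⟩, Equiv.ext fun s => ?_⟩
      exact (hR a s (σ s)).1 ((ha s (σ s)).2 rfl)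
    · rintro ⟨_, ⟨a, rfl⟩, rfl⟩
      exact ⟨a, hR a⟩
  rw [← card_closure_range_eq_pow_rankMod M, genGroup, hset, ← MonoidHom.map_closure,
    Subgroup.card_map_of_injective hΦ]
  have : Subgroup.closure (Set.range u) = AddSubgroup.toSubgroup
      (AddSubgroup.closure (Set.range fun a j => (M a j : ZMod p))) := by
    rw [AddSubgroup.toSubgroup_closure]
    congr 1
  rw [this]
  rfl

open Classical in
/-- The diagonal matrix with entries `1` at the elements of `D` and `0` elsewhere. -/
noncomputable def diagMatrix {I : Type} (D : Set I) (a j : I) : ℕ := if a = j ∧ a ∈ D then 1 else 0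

/-- This realises any cardinality as a rank, in every characteristic, and so gives the yardstick for
other ranks. -/
theorem rankMod_diagMatrix [Fact p.Prime] {I : Type} [Fintype I] (D : Set I) :
    rankMod p (diagMatrix D) = D.ncard := by
  classical
  have : (Matrix.of fun (b : I) (a : I) => (diagMatrix D a b : ZMod p)) =
      Matrix.diagonal fun i => if i ∈ D then 1 else 0 := by
    ext b a
    by_cases h : b = a
    · subst h; simp [diagMatrix]
    · simp [diagMatrix, h, Ne.symm h]
  rw [rankMod, this, Matrix.rank_diagonal, ← Nat.card_coe_set_eq, Nat.card_eq_fintype_card]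
  apply Fintype.card_congr
  exact Equiv.subtypeEquivRight fun i => by simp

theorem rankMod_le_card [Fintype P] [Fintype J] [Fact p.Prime] (M : P → J → ℕ) :
    rankMod p M ≤ Fintype.card J := Matrix.rank_le_card_height _

end ShiftGroup

/-! ### Tuples of digits -/

section Digits

variable {A : Type} [Fintype A] {k : ℕ}

theorem numVal_succ (c : Fin (k + 1) → Num A) :
    numVal c = Fintype.card A ^ k * (c 0 : ℕ) + numVal fun i => c i.succ := by
  rw [numVal, Fin.sum_univ_succ, numVal]
  congr 1
  apply Finset.sum_congr rfl
  intro i _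
  congr 2
  simp only [Fin.val_succ]
  omega

theorem numVal_lt_of_digits (c : Fin k → Num A) (h : ∀ i, (c i : ℕ) < Fintype.card A) :
    numVal c < Fintype.card A ^ k := by
  induction k with
  | zero => simp [numVal]
  | succ k ih =>
    have h1 := ih (fun i => c i.succ) fun i => h _
    rw [numVal_succ]
    calc _ < Fintype.card A ^ k * (c 0 : ℕ) + Fintype.card A ^ k := by omega
      _ = Fintype.card A ^ k * (c 0 + 1) := by ring
      _ ≤ Fintype.card A ^ k * Fintype.card A := Nat.mul_le_mul_left _ (h 0)
      _ = _ := (pow_succ _ _).symm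

/-- Uniqueness of base-`|A|` expansions. It needs the bound on the digits, since a number variable
may also take the value `|A|`. -/
theorem numVal_injOn_digits (c d : Fin k → Num A) (hc : ∀ i, (c i : ℕ) < Fintype.card A)
    (hd : ∀ i, (d i : ℕ) < Fintype.card A) (h : numVal c = numVal d) : c = d := by
  induction k with
  | zero => exact Subsingleton.elim _ _
  | succ k ih =>
    have h1 := numVal_lt_of_digits (fun i => c i.succ) fun i => hc _
    have h2 := numVal_lt_of_digits (fun i => d i.succ) fun i => hd _
    have h0 : 0 < Fintype.card A ^ k := by omega
    rw [numVal_succ, numVal_succ] at h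
    have e : (c 0 : ℕ) = d 0 := by
      have := congrArg (· / Fintype.card A ^ k) h
      simpa [Nat.mul_add_div h0, Nat.div_eq_of_lt h1, Nat.div_eq_of_lt h2] using this
    rw [e] at h
    have ht := ih _ _ (fun i => hc i.succ) (fun i => hd i.succ) (Nat.add_left_cancel h)
    funext i
    refine Fin.cases (Fin.ext e) (fun i => congrFun ht i) i

theorem exists_digits {m : ℕ} (hm : m < Fintype.card A ^ k) :
    ∃ c : Fin k → Num A, (∀ i, (c i : ℕ) < Fintype.card A) ∧ numVal c = m := by
  induction k generalizing m with
  | zero => exact ⟨fun i => i.elim0, fun i => i.elim0, by simp at hm; simp [numVal, hm]⟩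
  | succ k ih =>
    have h0 : 0 < Fintype.card A ^ k := by
      rcases Nat.eq_zero_or_pos (Fintype.card A ^ k) with h | h
      · rw [pow_succ, h] at hm; omega
      · exact h
    obtain ⟨c, hc, hv⟩ := ih (Nat.mod_lt m h0)
    have hd : m / Fintype.card A ^ k < Fintype.card A :=
      Nat.div_lt_of_lt_mul (by rwa [← pow_succ])
    refine ⟨Fin.cons ⟨m / Fintype.card A ^ k, by omega⟩ c, ?_, ?_⟩
    · intro i
      refine Fin.cases ?_ (fun i => ?_) i
      · simpa using hd
      · simpa using hc i
    · rw [numVal_succ]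
      simp only [Fin.cons_zero, Fin.cons_succ, hv]
      exact Nat.div_add_mod m _

/-- The tuples that code the residues modulo `p`. -/
def IsCode (p : ℕ) (c : Fin k → Num A) : Prop :=
  (∀ i, (c i : ℕ) < Fintype.card A) ∧ numVal c < p

/-- The codes are in bijection with `ℤ/p`: `k` digits suffice to write every residue below `p ≤ |A|
^ k`. -/
theorem exists_code {p : ℕ} [NeZero p] (hp : p ≤ Fintype.card A ^ k) :
    ∃ code : ZMod p → Fin k → Num A, (∀ z, IsCode p (code z)) ∧ (∀ z, numVal (code z) = z.val) ∧
      ∀ c, IsCode p c → code (numVal c : ZMod p) = c := by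
  choose code h1 h2 using fun z : ZMod p =>
    exists_digits (A := A) (k := k) ((ZMod.val_lt z).trans_le hp)
  refine ⟨code, fun z => ⟨h1 z, h2 z ▸ ZMod.val_lt z⟩, h2, fun c hc => ?_⟩
  exact numVal_injOn_digits _ _ (h1 _) hc.1 (by rw [h2, ZMod.val_natCast, Nat.mod_eq_of_lt hc.2])

theorem card_carrier (s : Srt) : Fintype.card (Carrier A s) ≤ Fintype.card A + 1 := by
  cases s with
  | element => exact Nat.le_succ _
  | number => exact (Fintype.card_fin _).le

/-- The numerical sort has `|A| + 1` elements, which is at most `|A| ^ 2` once `|A| ≥ 2`; this costs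
the factor `2` in the exponent. -/
theorem card_tuple_le (hA : 2 ≤ Fintype.card A) (T : Ty) :
    Fintype.card (Tuple A T) ≤ Fintype.card A ^ (2 * T.len) := by
  rw [Fintype.card_pi, pow_mul]
  calc _ ≤ ∏ _i : Fin T.len, Fintype.card A ^ 2 :=
        Finset.prod_le_prod' fun i _ => (card_carrier _).trans (by nlinarith)
    _ = _ := by simp

/-- Orders that are not too large are determined by the bits that the operator `ord` can see. -/
theorem ordRel_eq_ordRel_iff {U U' T : Ty} {R : Tuple A U → Tuple A T → Tuple A T → Prop}
    {R' : Tuple A U' → Tuple A T → Tuple A T → Prop}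
    (h : Nat.card (genGroup R) < 2 ^ Fintype.card A ^ (2 * T.len))
    (h' : Nat.card (genGroup R') < 2 ^ Fintype.card A ^ (2 * T.len)) :
    ordRel R = ordRel R' ↔ Nat.card (genGroup R) = Nat.card (genGroup R') := by
  constructor
  · intro e
    apply Nat.eq_of_testBit_eq
    intro i
    by_cases hi : i < Fintype.card A ^ (2 * T.len)
    -- Every relevant bit position is denoted by some tuple of length `2 * T.len`; all higher bits
    -- vanish by the size bounds.
    · obtain ⟨c, -, rfl⟩ := exists_digits hi
      have := Set.ext_iff.1 e c
      simpa only [ordRel, Set.mem_ofPred_eq, ← Bool.eq_iff_iff] using this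
    · have h2 : 2 ^ Fintype.card A ^ (2 * T.len) ≤ 2 ^ i := Nat.pow_le_pow_right (by norm_num)
        (not_lt.1 hi)
      rw [Nat.testBit_lt_two_pow (h.trans_le h2), Nat.testBit_lt_two_pow (h'.trans_le h2)]
  · intro e
    rw [ordRel, ordRel, e]

variable {P J K B : Type} {p : ℕ}

/-- For every `a`, the graph of the permutation of `B ≃ J × K × number ^ k` that adds `M a j` to
the codes of residues modulo `p`, and leaves all other tuples fixed. -/
def shiftRel (E : B ≃ J × K × (Fin k → Num A)) (p : ℕ) (M : P → J → ℕ) (a : P) (s t : B) : Prop :=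
  ((IsCode p (E s).2.2 ∧ IsCode p (E t).2.2 ∧
    numVal (E t).2.2 ≡ numVal (E s).2.2 + M a (E s).1 [MOD p]) ∧
      (E s).1 = (E t).1 ∧ (E s).2.1 = (E t).2.1) ∨
  (¬ IsCode p (E s).2.2 ∧ s = t)

theorem card_genGroup_shiftRel [Fintype P] [Finite J] [Nonempty K] [Fact p.Prime]
    (hp : p ≤ Fintype.card A ^ k) (E : B ≃ J × K × (Fin k → Num A)) (M : P → J → ℕ) :
    Nat.card (genGroup (shiftRel E p M)) = p ^ rankMod p M := by
  obtain ⟨code, h1, h2, h3⟩ := exists_code hp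
  have hinj : Function.Injective code := fun z z' h =>
    ZMod.val_injective p (by rw [← h2, ← h2, h])
  -- The range of `Ψ` consists of the tuples whose last block is a code; `shiftRel` fixes all
  -- others.
  let Ψ : J × K × ZMod p ↪ B :=
    ⟨fun x => E.symm (x.1, x.2.1, code x.2.2), by
      rintro ⟨j, κ, z⟩ ⟨j', κ', z'⟩ h
      simp only [EmbeddingLike.apply_eq_iff_eq, Prod.mk.injEq] at h
      obtain ⟨rfl, rfl, h⟩ := h
      rw [hinj h]⟩
  have hΨ : ∀ x, E (Ψ x) = (x.1, x.2.1, code x.2.2) := fun x => E.apply_symm_apply _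
  apply card_genGroup_of_shift M Ψ
  · intro a j κ z t
    simp only [shiftRel, hΨ, h1, true_and, not_true, false_and, or_false]
    constructor
    · rintro ⟨⟨hc, hm⟩, rfl, rfl⟩
      apply E.injective
      rw [hΨ]
      refine Prod.ext rfl (Prod.ext rfl ?_)
      have := (ZMod.natCast_eq_natCast_iff _ _ _).2 hm
      rw [h2, Nat.cast_add, ZMod.natCast_zmod_val] at this
      exact this ▸ h3 _ hc
    · rintro rfl
      rw [hΨ]
      refine ⟨⟨h1 _, ?_⟩, rfl, rfl⟩
      rw [← ZMod.natCast_eq_natCast_iff]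
      simp [h2]
  · intro a s t hs
    have : ¬ IsCode p (E s).2.2 := fun hc =>
      hs ⟨((E s).1, (E s).2.1, (numVal (E s).2.2 : ZMod p)), by
        apply E.injective
        rw [hΨ]
        exact Prod.ext rfl (Prod.ext rfl (h3 _ hc))⟩
    simp [shiftRel, this]

/-- The crude bound `p < 2 ^ p` suffices, because `|J| * p` is polynomial in `|A|` in the
applications. -/
theorem pow_rankMod_lt [Fintype P] [Fintype J] [Nonempty J] [Fact p.Prime] {N : ℕ}
    (h : Fintype.card J * p ≤ N) (M : P → J → ℕ) : p ^ rankMod p M < 2 ^ N := by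
  have hp : 0 < p := (Fact.out : p.Prime).pos
  have hJ : 0 < Fintype.card J := Fintype.card_pos
  calc p ^ rankMod p M ≤ p ^ Fintype.card J := Nat.pow_le_pow_right hp (rankMod_le_card M)
    _ < (2 ^ p) ^ Fintype.card J := Nat.pow_lt_pow_left Nat.lt_two_pow_self hJ.ne'
    _ = 2 ^ (Fintype.card J * p) := by rw [← pow_mul, mul_comm]
    _ ≤ 2 ^ N := Nat.pow_le_pow_right (by norm_num) h

end Digits

/-! ### Splitting tuples into blocks -/

theorem carrier_cast_apply {A : Type} [Fintype A] {ι : Type} {s : ι → Srt}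
    (g : (x : ι) → Carrier A (s x)) {x y : ι} (h : x = y) :
    (congrArg s h ▸ g x : Carrier A (s y)) = g y := by
  subst h; rfl

/-- A way to read the tuples of type `T` as triples of a tuple of type `Y`, a tuple of type `Z`, and
`k` numbers. -/
structure TupleSplit (T Y Z : Ty) (k : ℕ) : Type 1 where
  equiv : (A : Type) → [Fintype A] → Tuple A T ≃ Tuple A Y × Tuple A Z × (Fin k → Num A)
  isArgs_fst : ∀ {S : Signature} {Γ : Ctx}, IsArgs (S := S) (T := Y)
    fun 𝔄 (w : Assignment (Γ.bind T) 𝔄.Dom) => (equiv 𝔄.Dom w.new).1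
  isArgs_snd : ∀ {S : Signature} {Γ : Ctx}, IsArgs (S := S) (T := Z)
    fun 𝔄 (w : Assignment (Γ.bind T) 𝔄.Dom) => (equiv 𝔄.Dom w.new).2.1
  isArgs_code : ∀ {S : Signature} {Γ : Ctx}, IsArgs (S := S) (T := Ty.num k)
    fun 𝔄 (w : Assignment (Γ.bind T) 𝔄.Dom) => (equiv 𝔄.Dom w.new).2.2

/-- The split with the first two components exchanged. -/
def TupleSplit.swap {T Y Z : Ty} {k : ℕ} (E : TupleSplit T Y Z k) : TupleSplit T Z Y k where
  equiv A _ := (E.equiv A).trans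
    ⟨fun x => (x.2.1, x.1, x.2.2), fun x => (x.2.1, x.1, x.2.2), fun _ => rfl, fun _ => rfl⟩
  isArgs_fst := E.isArgs_snd
  isArgs_snd := E.isArgs_fst
  isArgs_code := E.isArgs_code

/-- The positions of three consecutive blocks. -/
def blockEquiv (a b c : ℕ) : Fin a ⊕ (Fin b ⊕ Fin c) ≃ Fin (a + (b + c)) :=
  (Equiv.sumCongr (Equiv.refl _) finSumFinEquiv).trans finSumFinEquiv

/-- The sorts of a block of type `Y` followed by `t + k` numbers. -/
def blockSort (Y : Ty) (t k : ℕ) : Fin Y.len ⊕ (Fin t ⊕ Fin k) → Srt :=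
  Sum.elim Y.sort fun _ => Srt.number

/-- The word `Y`, followed by `number ^ t` and `number ^ k`. -/
def Ty.block (Y : Ty) (t k : ℕ) : Ty :=
  ⟨Y.len + (t + k), fun j => blockSort Y t k ((blockEquiv _ _ _).symm j)⟩

/-- The tuples of type `Y.block t k`, as families indexed by positions in the blocks. -/
def blockTupleEquiv (Y : Ty) (t k : ℕ) (A : Type) [Fintype A] :
    Tuple A (Y.block t k) ≃ ((x : Fin Y.len ⊕ (Fin t ⊕ Fin k)) → Carrier A (blockSort Y t k x)) where
  toFun a x := (congrArg (blockSort Y t k) ((blockEquiv _ _ _).symm_apply_apply x) ▸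
    (show Carrier A (blockSort Y t k ((blockEquiv _ _ _).symm (blockEquiv _ _ _ x))) from
      a (blockEquiv _ _ _ x)) : Carrier A (blockSort Y t k x))
  invFun g j := g ((blockEquiv _ _ _).symm j)
  left_inv a := by
    funext j
    have : ∀ (x y : Fin (Y.block t k).len) (h : x = y),
        (congrArg (Y.block t k).sort h ▸ a x : Carrier A ((Y.block t k).sort y)) = a y := by
      intro x y h; subst h; rfl
    exact this _ _ ((blockEquiv _ _ _).apply_symm_apply j)
  right_inv g := funext fun x =>
    carrier_cast_apply g ((blockEquiv _ _ _).symm_apply_apply x)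

/-- The split of `Y.block t k` into its three blocks. -/
def TupleSplit.block (Y : Ty) (t k : ℕ) : TupleSplit (Y.block t k) Y (Ty.num t) k where
  equiv A _ := (blockTupleEquiv Y t k A).trans
    ⟨fun g => (fun i => g (Sum.inl i), fun i => g (Sum.inr (Sum.inl i)),
        fun i => g (Sum.inr (Sum.inr i))),
      fun x => fun
        | Sum.inl i => x.1 i
        | Sum.inr (Sum.inl i) => x.2.1 i
        | Sum.inr (Sum.inr i) => x.2.2 i,
      fun g => by funext x; rcases x with i | i | i <;> rfl,
      fun x => rfl⟩
  isArgs_fst i := ⟨⟨Sum.inr (blockEquiv _ _ _ (Sum.inl i)),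
    congrArg (blockSort Y t k) ((blockEquiv _ _ _).symm_apply_apply _)⟩, fun _ _ => rfl⟩
  isArgs_snd i := ⟨⟨Sum.inr (blockEquiv _ _ _ (Sum.inr (Sum.inl i))),
    congrArg (blockSort Y t k) ((blockEquiv _ _ _).symm_apply_apply _)⟩, fun _ _ => rfl⟩
  isArgs_code i := ⟨⟨Sum.inr (blockEquiv _ _ _ (Sum.inr (Sum.inr i))),
    congrArg (blockSort Y t k) ((blockEquiv _ _ _).symm_apply_apply _)⟩, fun _ _ => rfl⟩

/-! ### Definability of the shifts; numbers as cardinalities of definable sets. -/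

section

variable {S : Signature} {Γ : Ctx}

/-- The values of a block of new numerical variables. -/
abbrev Assignment.nums {A : Type} [Fintype A] {k : ℕ} (w : Assignment (Γ.bind (Ty.num k)) A) :
    Fin k → Num A := w.new

namespace Definable

/-- A number is less than `|A|` iff some number is larger, since `|A|` is the greatest element of
the numerical sort. -/
theorem digits {k : ℕ} : Definable (S := S)
    fun 𝔄 (w : Assignment (Γ.bind (Ty.num k)) 𝔄.Dom) =>
      ∀ i : Fin k, (w.nums i : ℕ) < Fintype.card 𝔄.Dom := by
  refine forall_fin fun i => ?_
  have h : Definable (S := S) fun 𝔄 (w : Assignment (Γ.bind (Ty.num k)) 𝔄.Dom) =>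
      ∃ z : Tuple 𝔄.Dom (Ty.num 1), w.nums i < z 0 :=
    ex (T := Ty.num 1)
      (P := fun 𝔄 (w : Assignment (Γ.bind (Ty.num k)) 𝔄.Dom) z => w.nums i < z 0)
      (lt (isVar_new (T := Ty.num k) i).old (isVar_new (T := Ty.num 1) 0))
  refine h.congr fun 𝔄 _ w => ?_
  constructor
  · intro hi
    exact ⟨fun _ => Fin.last _, hi⟩
  · rintro ⟨z, hz⟩
    exact (Fin.lt_def.1 hz).trans_le (Nat.lt_succ_iff.1 (Fin.is_lt _))

/-- Definability of the shift of the codes of residues. -/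
theorem shiftRel {U T Y Z : Ty} {k : ℕ} (E : TupleSplit T Y Z k)
    {p : (𝔄 : FinStr S) → Assignment Γ 𝔄.Dom → ℕ}
    {M : (𝔄 : FinStr S) → Assignment Γ 𝔄.Dom → Tuple 𝔄.Dom U → Tuple 𝔄.Dom Y → ℕ}
    (hp : Definable fun 𝔄 (w : Assignment (Γ.bind (Ty.num k)) 𝔄.Dom) =>
      IsCode (p 𝔄 w.old) w.nums)
    (hM : Definable fun 𝔄
      (w : Assignment ((((Γ.bind U).bind Y).bind (Ty.num k)).bind (Ty.num k)) 𝔄.Dom) =>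
      IsCode (p 𝔄 w.old.old.old.old) w.old.nums ∧ IsCode (p 𝔄 w.old.old.old.old) w.nums ∧
      numVal w.nums ≡ numVal w.old.nums +
        M 𝔄 w.old.old.old.old w.old.old.old.new w.old.old.new [MOD p 𝔄 w.old.old.old.old]) :
    Definable fun 𝔄 (w : Assignment (((Γ.bind U).bind T).bind T) 𝔄.Dom) =>
      OrderLogic.shiftRel (E.equiv 𝔄.Dom) (p 𝔄 w.old.old.old) (M 𝔄 w.old.old.old) w.old.old.new
        w.old.new w.new := by
  have hG : IsPull (S := S) fun 𝔄 (w : Assignment (((Γ.bind U).bind T).bind T) 𝔄.Dom) =>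
      w.old.old.old := (isPull_id (Γ := Γ)).old.old.old
  have hU : IsArgs (S := S) fun 𝔄 (w : Assignment (((Γ.bind U).bind T).bind T) 𝔄.Dom) =>
      w.old.old.new := (isArgs_new (T := U)).old.old
  have f1 := (E.isArgs_fst (S := S) (Γ := Γ.bind U)).old (T := T)
  have f2 := (E.isArgs_snd (S := S) (Γ := Γ.bind U)).old (T := T)
  have f3 := (E.isArgs_code (S := S) (Γ := Γ.bind U)).old (T := T)
  have g1 := E.isArgs_fst (S := S) (Γ := (Γ.bind U).bind T)
  have g2 := E.isArgs_snd (S := S) (Γ := (Γ.bind U).bind T)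
  have g3 := E.isArgs_code (S := S) (Γ := (Γ.bind U).bind T)
  refine or (and ?_ (and ?_ ?_)) (and (not ?_) ?_)
  -- The matrix column is the first block of `s`; the two residues are the code blocks of `s` and
  -- `t`.
  · exact hM.comp ((((hG.bind hU).bind f1).bind f3).bind g3)
  · exact eq_tuple f1 g1
  · exact eq_tuple f2 g2
  · exact hp.comp (hG.bind f3)
  · exact eq_tuple isArgs_new.old isArgs_new

end Definable

/-- The set `D` of tuples of numbers, depending on the structure and an assignment, is definable. -/
def DefinableSet {t : ℕ} (D : (𝔄 : FinStr S) → Assignment Γ 𝔄.Dom → Set (Fin t → Num 𝔄.Dom)) :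
    Prop :=
  Definable fun 𝔄 (w : Assignment (Γ.bind (Ty.num t)) 𝔄.Dom) => w.nums ∈ D 𝔄 w.old

/-- The numbers `f` are the cardinalities of sets of tuples of numbers, uniformly definable on
structures with at least two elements. -/
def DefinableNat (f : (𝔄 : FinStr S) → Assignment Γ 𝔄.Dom → ℕ) : Prop :=
  ∃ (t : ℕ) (D : (𝔄 : FinStr S) → Assignment Γ 𝔄.Dom → Set (Fin t → Num 𝔄.Dom)),
    DefinableSet D ∧
    ∀ 𝔄 : FinStr S, 2 ≤ Fintype.card 𝔄.Dom → ∀ v, f 𝔄 v = (D 𝔄 v).ncard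


end

/-! ### Comparison of ranks -/

section

variable {S : Signature} {Γ : Ctx}

theorem nonempty_tuple {A : Type} [Fintype A] (hA : 2 ≤ Fintype.card A) (T : Ty) :
    Nonempty (Tuple A T) := by
  have : Nonempty A := Fintype.card_pos_iff.1 (by omega)
  have : ∀ s, Nonempty (Carrier A s)
    | Srt.element => this
    | Srt.number => ⟨(0 : Num A)⟩
  exact ⟨fun i => (this _).some⟩

/-- The orders are `p` to the two ranks, and the length conditions make them small enough for all
their bits to be visible. The ranks then agree because `r ↦ p ^ r` is injective. -/
theorem ordRel_shiftRel_eq_iff {A : Type} [Fintype A] (hA : 2 ≤ Fintype.card A) {p k : ℕ}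
    [Fact p.Prime] (hp : p ≤ Fintype.card A ^ k) {U U' T Y Y' Z Z' : Ty} (E : TupleSplit T Y Z k)
    (E' : TupleSplit T Y' Z' k) (h : 2 * Y.len + k ≤ 2 * T.len) (h' : 2 * Y'.len + k ≤ 2 * T.len)
    (M : Tuple A U → Tuple A Y → ℕ) (M' : Tuple A U' → Tuple A Y' → ℕ) :
    ordRel (shiftRel (E.equiv A) p M) = ordRel (shiftRel (E'.equiv A) p M') ↔
      rankMod p M = rankMod p M' := by
  have := nonempty_tuple hA
  have key : ∀ Y : Ty, 2 * Y.len + k ≤ 2 * T.len →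
      Fintype.card (Tuple A Y) * p ≤ Fintype.card A ^ (2 * T.len) := by
    intro Y h
    calc _ ≤ Fintype.card A ^ (2 * Y.len) * Fintype.card A ^ k :=
          Nat.mul_le_mul (card_tuple_le hA Y) hp
      _ = Fintype.card A ^ (2 * Y.len + k) := (pow_add _ _ _).symm
      _ ≤ _ := Nat.pow_le_pow_right (by omega) h
  rw [ordRel_eq_ordRel_iff, card_genGroup_shiftRel hp, card_genGroup_shiftRel hp]
  · exact Nat.pow_right_inj (Fact.out : p.Prime).one_lt
  · rw [card_genGroup_shiftRel hp]
    exact pow_rankMod_lt (key Y h) M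
  · rw [card_genGroup_shiftRel hp]
    exact pow_rankMod_lt (key Y' h') M'

/-- Being at most `1` is expressed by the order alone, as having at most one predecessor: arithmetic
is only built later, on top of the case `p = 2`. -/
theorem isCode_two_iff {A : Type} [Fintype A] (c : Fin 1 → Num A) :
    IsCode 2 c ↔ (∀ i, (c i : ℕ) < Fintype.card A) ∧
      ∀ z z' : Fin 1 → Num A, z 0 < c 0 → z' 0 < c 0 → z 0 = z' 0 := by
  have hv : numVal c = c 0 := by simp [numVal]
  rw [IsCode, hv]
  refine and_congr_right fun h => ⟨fun h2 z z' hz hz' => ?_, fun h2 => ?_⟩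
  · rw [Fin.lt_def] at hz hz'
    apply Fin.ext
    omega
  · by_contra h3
    have h0 := h 0
    have := h2 (fun _ => ⟨0, by omega⟩) (fun _ => ⟨1, by omega⟩)
      (Fin.lt_def.2 (by simp only; omega)) (Fin.lt_def.2 (by simp only; omega))
    simp at this

/-- Modulo `2`, adding `1` means changing the residue and adding `0` means keeping it, so no
addition has to be defined. -/
theorem modEq_two_iff {A : Type} [Fintype A] {c d : Fin 1 → Num A} (hc : IsCode 2 c)
    (hd : IsCode 2 d) {I : Type} (D : Set I) (a j : I) :
    numVal d ≡ numVal c + diagMatrix D a j [MOD 2] ↔ ((a = j ∧ a ∈ D) ↔ c ≠ d) := by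
  have h1 : numVal c = numVal d ↔ c = d :=
    ⟨numVal_injOn_digits _ _ hc.1 hd.1, fun h => h ▸ rfl⟩
  have h2 := hc.2
  have h3 := hd.2
  rw [ne_eq, ← h1, Nat.ModEq, diagMatrix]
  split_ifs with h
  · rw [iff_true_left h]; omega
  · rw [iff_false_left h]; omega

namespace Definable

theorem isCode_two : Definable (S := S)
    fun 𝔄 (w : Assignment (Γ.bind (Ty.num 1)) 𝔄.Dom) => IsCode 2 w.nums := by
  refine congr (and digits ?_) fun 𝔄 _ w => isCode_two_iff w.nums
  refine all (T := Ty.num 1) (P := fun 𝔄 (w : Assignment (Γ.bind (Ty.num 1)) 𝔄.Dom)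
    (z : Tuple 𝔄.Dom (Ty.num 1)) => ∀ z' : Fin 1 → Num 𝔄.Dom,
      (show Num 𝔄.Dom from z 0) < w.nums 0 → z' 0 < w.nums 0 → (show Num 𝔄.Dom from z 0) = z' 0) ?_
  refine all (T := Ty.num 1) (P := fun 𝔄
    (w : Assignment ((Γ.bind (Ty.num 1)).bind (Ty.num 1)) 𝔄.Dom)
    (z' : Tuple 𝔄.Dom (Ty.num 1)) =>
      w.nums 0 < w.old.nums 0 → (show Num 𝔄.Dom from z' 0) < w.old.nums 0 →
        w.nums 0 = (show Num 𝔄.Dom from z' 0)) ?_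
  have h0 := isVar_new (S := S)
    (Γ := ((Γ.bind (Ty.num 1)).bind (Ty.num 1))) (T := Ty.num 1) 0
  have h1 := (isVar_new (S := S) (Γ := (Γ.bind (Ty.num 1))) (T := Ty.num 1) 0).old (T := Ty.num 1)
  have h2 := (isVar_new (S := S) (Γ := Γ) (T := Ty.num 1) 0).old (T := Ty.num 1) |>.old
    (T := Ty.num 1)
  exact imp (lt h1 h2) (imp (lt h0 h2) (eq h1 h0))

/-- Both cardinalities are ranks of diagonal matrices over `𝔽_2`, and these ranks are compared
through the group orders. -/
theorem ncard_eq_ncard {t : ℕ}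
    {D D' : (𝔄 : FinStr S) → Assignment Γ 𝔄.Dom → Set (Fin t → Num 𝔄.Dom)}
    (hD : DefinableSet D) (hD' : DefinableSet D') :
    Definable fun 𝔄 v => (D 𝔄 v).ncard = (D' 𝔄 v).ncard := by
  -- The matrix index is the block of `t` numbers, the idle factor is a single point, and one digit
  -- codes the residues modulo `2`.
  let E := (TupleSplit.block (Ty.num 0) t 1).swap
  have key : ∀ {D : (𝔄 : FinStr S) → Assignment Γ 𝔄.Dom → Set (Fin t → Num 𝔄.Dom)},
      DefinableSet D →
      Definable fun 𝔄 (w : Assignment (((Γ.bind (Ty.num t)).bind ((Ty.num 0).block t 1)).bind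
        ((Ty.num 0).block t 1)) 𝔄.Dom) =>
        OrderLogic.shiftRel (E.equiv 𝔄.Dom) 2 (diagMatrix (D 𝔄 w.old.old.old)) w.old.old.new
          w.old.new w.new := by
    intro D hD
    refine shiftRel E (p := fun _ _ => 2) (M := fun 𝔄 v => diagMatrix (D 𝔄 v)) isCode_two ?_
    have h1 := isCode_two (S := S) (Γ := (((Γ.bind (Ty.num t)).bind (Ty.num t)).bind (Ty.num 1)))
    have h2 := (isCode_two (S := S) (Γ := ((Γ.bind (Ty.num t)).bind (Ty.num t)))).old (T := Ty.num 1)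
    have a0 := isArgs_new (S := S) (Γ := (((Γ.bind (Ty.num t)).bind (Ty.num t)).bind (Ty.num 1)))
      (T := Ty.num 1)
    have a1 := (isArgs_new (S := S) (Γ := ((Γ.bind (Ty.num t)).bind (Ty.num t)))
      (T := Ty.num 1)).old (T := Ty.num 1)
    have a2 := ((isArgs_new (S := S) (Γ := (Γ.bind (Ty.num t)))
      (T := Ty.num t)).old (T := Ty.num 1)).old (T := Ty.num 1)
    have a3 := (((isArgs_new (S := S) (Γ := Γ)
      (T := Ty.num t)).old (T := Ty.num t)).old (T := Ty.num 1)).old (T := Ty.num 1)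
    have h3 := Definable.comp hD ((((((isPull_id (S := S) (Γ := Γ)).old (T := Ty.num t)).old
      (T := Ty.num t)).old (T := Ty.num 1)).old (T := Ty.num 1)).bind a3)
    refine (h2.and (h1.and (((eq_tuple a3 a2).and h3).iff (eq_tuple a1 a0).not))).congr
      fun 𝔄 _ w => ?_
    exact and_congr_right fun h => and_congr_right fun h' => modEq_two_iff h h' _ _ _
  refine (ordRel_eq
    (R := fun 𝔄 v => OrderLogic.shiftRel (E.equiv 𝔄.Dom) 2 (diagMatrix (D 𝔄 v)))
    (R' := fun 𝔄 v => OrderLogic.shiftRel (E.equiv 𝔄.Dom) 2 (diagMatrix (D' 𝔄 v)))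
    (U := Ty.num t) (U' := Ty.num t) (key hD) (key hD')).congr fun 𝔄 hA v => ?_
  have : Fact (Nat.Prime 2) := ⟨Nat.prime_two⟩
  have hl : 2 * (Ty.num t).len + 1 ≤ 2 * ((Ty.num 0).block t 1).len := by
    simp only [Ty.block]; omega
  rw [← rankMod_diagMatrix (p := 2), ← rankMod_diagMatrix (p := 2)]
  exact (ordRel_shiftRel_eq_iff hA (by simpa using hA) E E hl hl (U := Ty.num t) (U' := Ty.num t)
    (diagMatrix (D 𝔄 v)) (diagMatrix (D' 𝔄 v))).symm

end Definable

end

/-! ### Arithmetic -/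

section

variable {S : Signature} {Γ : Ctx}

/-- The set of the concatenations of tuples in `D` and in `D'`. -/
def appendSet {B : Type} {s t : ℕ} (D : Set (Fin s → B)) (D' : Set (Fin t → B)) :
    Set (Fin (s + t) → B) :=
  {a | (fun i => a (Fin.castAdd t i)) ∈ D ∧ (fun i => a (Fin.natAdd s i)) ∈ D'}

theorem ncard_appendSet {B : Type} {s t : ℕ} (D : Set (Fin s → B)) (D' : Set (Fin t → B)) :
    (appendSet D D').ncard = D.ncard * D'.ncard := by
  rw [← Set.ncard_prod, ← Set.ncard_image_of_injective _ (Fin.appendEquiv s t).symm.injective]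
  congr 1
  ext ⟨x, y⟩
  simp only [Set.mem_image_equiv, Equiv.symm_symm, Set.mem_prod, appendSet]
  simp [Fin.appendEquiv]

theorem isArgs_left {s t : ℕ} : IsArgs (S := S) (T := Ty.num s)
    fun 𝔄 (w : Assignment (Γ.bind (Ty.num (s + t))) 𝔄.Dom) => fun i => w.nums (Fin.castAdd t i) :=
  fun i => isVar_new (T := Ty.num (s + t)) (Fin.castAdd t i)

theorem isArgs_right {s t : ℕ} : IsArgs (S := S) (T := Ty.num t)
    fun 𝔄 (w : Assignment (Γ.bind (Ty.num (s + t))) 𝔄.Dom) => fun i => w.nums (Fin.natAdd s i) :=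
  fun i => isVar_new (T := Ty.num (s + t)) (Fin.natAdd s i)

theorem DefinableSet.append {s t : ℕ}
    {D : (𝔄 : FinStr S) → Assignment Γ 𝔄.Dom → Set (Fin s → Num 𝔄.Dom)}
    {D' : (𝔄 : FinStr S) → Assignment Γ 𝔄.Dom → Set (Fin t → Num 𝔄.Dom)}
    (hD : DefinableSet D) (hD' : DefinableSet D') :
    DefinableSet fun 𝔄 v => appendSet (D 𝔄 v) (D' 𝔄 v) := by
  have hG := (isPull_id (S := S) (Γ := Γ)).old (T := Ty.num (s + t))
  exact (Definable.comp hD (hG.bind (T := Ty.num s) (isArgs_left (s := s) (t := t)))).and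
    (Definable.comp hD' (hG.bind (T := Ty.num t) (isArgs_right (s := s) (t := t))))

theorem DefinableSet.union {t : ℕ}
    {D D' : (𝔄 : FinStr S) → Assignment Γ 𝔄.Dom → Set (Fin t → Num 𝔄.Dom)}
    (hD : DefinableSet D) (hD' : DefinableSet D') :
    DefinableSet fun 𝔄 v => D 𝔄 v ∪ D' 𝔄 v :=
  Definable.or hD hD'

/-- The constant tuples `0` and `|A|` are singletons used for padding sets to a common length and
for tagging the two parts of a disjoint union. -/
theorem definableSet_zero {t : ℕ} : DefinableSet (S := S) (Γ := Γ) (t := t)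
    fun _ _ => {fun _ => 0} := by
  have h : ∀ i : Fin t, Definable (S := S) fun 𝔄 (w : Assignment (Γ.bind (Ty.num t)) 𝔄.Dom) =>
      ∀ z : Tuple 𝔄.Dom (Ty.num 1), ¬ (show Num 𝔄.Dom from z 0) < w.nums i := fun i =>
    Definable.all (T := Ty.num 1) (P := fun 𝔄 (w : Assignment (Γ.bind (Ty.num t)) 𝔄.Dom)
        (z : Tuple 𝔄.Dom (Ty.num 1)) => ¬ (show Num 𝔄.Dom from z 0) < w.nums i)
      (Definable.not (Definable.lt (isVar_new (T := Ty.num 1) 0) (isVar_new (T := Ty.num t) i).old))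
  refine (Definable.forall_fin h).congr fun 𝔄 _ w => ?_
  rw [Set.mem_singleton_iff, funext_iff]
  refine forall_congr' fun i => ⟨fun hi z => ?_, fun hz => ?_⟩
  · rw [hi]; exact Fin.not_lt_zero _
  · exact Fin.le_zero_iff.1 (not_lt.1 (hz fun _ => (0 : Num 𝔄.Dom)))

theorem definableSet_last {t : ℕ} : DefinableSet (S := S) (Γ := Γ) (t := t)
    fun _ _ => {fun _ => Fin.last _} := by
  have h : ∀ i : Fin t, Definable (S := S) fun 𝔄 (w : Assignment (Γ.bind (Ty.num t)) 𝔄.Dom) =>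
      ∀ z : Tuple 𝔄.Dom (Ty.num 1), ¬ w.nums i < (show Num 𝔄.Dom from z 0) := fun i =>
    Definable.all (T := Ty.num 1) (P := fun 𝔄 (w : Assignment (Γ.bind (Ty.num t)) 𝔄.Dom)
        (z : Tuple 𝔄.Dom (Ty.num 1)) => ¬ w.nums i < (show Num 𝔄.Dom from z 0))
      (Definable.not (Definable.lt (isVar_new (T := Ty.num t) i).old (isVar_new (T := Ty.num 1) 0)))
  refine (Definable.forall_fin h).congr fun 𝔄 _ w => ?_
  rw [Set.mem_singleton_iff, funext_iff]
  refine forall_congr' fun i => ⟨fun hi z => ?_, fun hz => ?_⟩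
  · rw [hi]; exact not_lt.2 (Fin.le_last _)
  · exact Fin.last_le_iff.1 (not_lt.1 (hz fun _ => (Fin.last _ : Num 𝔄.Dom)))

namespace DefinableNat

variable {f g : (𝔄 : FinStr S) → Assignment Γ 𝔄.Dom → ℕ}

theorem congr (hf : DefinableNat f)
    (h : ∀ 𝔄 : FinStr S, 2 ≤ Fintype.card 𝔄.Dom → ∀ v, g 𝔄 v = f 𝔄 v) : DefinableNat g := by
  obtain ⟨t, D, hD, hf⟩ := hf
  exact ⟨t, D, hD, fun 𝔄 hA v => (h 𝔄 hA v).trans (hf 𝔄 hA v)⟩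

theorem comp (hf : DefinableNat f) {V' : Type} {s' : V' → Srt}
    {F : (𝔄 : FinStr S) → Assignment ⟨V', s', Γ.RVar, Γ.rtype⟩ 𝔄.Dom → Assignment Γ 𝔄.Dom}
    (hF : IsPull F) : DefinableNat fun 𝔄 v => f 𝔄 (F 𝔄 v) := by
  obtain ⟨t, D, hD, hf⟩ := hf
  exact ⟨t, fun 𝔄 v => D 𝔄 (F 𝔄 v), Definable.comp hD (hF.old.bind isArgs_new), fun 𝔄 hA v => hf 𝔄 hA _⟩

theorem old {T : Ty} (hf : DefinableNat f) :
    DefinableNat (fun 𝔄 (w : Assignment (Γ.bind T) 𝔄.Dom) => f 𝔄 w.old) :=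
  hf.comp (F := fun 𝔄 (w : Assignment (Γ.bind T) 𝔄.Dom) => w.old) (isPull_id (Γ := Γ)).old

theorem one : DefinableNat (S := S) (Γ := Γ) fun _ _ => 1 :=
  ⟨0, fun _ _ => {fun _ => 0}, definableSet_zero, fun _ _ _ => (Set.ncard_singleton _).symm⟩

theorem zero : DefinableNat (S := S) (Γ := Γ) fun _ _ => 0 :=
  ⟨0, fun _ _ => ∅, Definable.false, fun _ _ _ => (Set.ncard_empty _).symm⟩

theorem mul (hf : DefinableNat f) (hg : DefinableNat g) :
    DefinableNat fun 𝔄 v => f 𝔄 v * g 𝔄 v := by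
  obtain ⟨s, D, hD, hf⟩ := hf
  obtain ⟨t, D', hD', hg⟩ := hg
  exact ⟨s + t, _, hD.append hD', fun 𝔄 hA v => by
    simp only [hf 𝔄 hA, hg 𝔄 hA, ncard_appendSet]⟩

theorem add (hf : DefinableNat f) (hg : DefinableNat g) :
    DefinableNat fun 𝔄 v => f 𝔄 v + g 𝔄 v := by
  obtain ⟨s, D, hD, hf⟩ := hf
  obtain ⟨t, D', hD', hg⟩ := hg
  -- Both sets are padded with zeros to length `s + t`; a last entry `0` or `|A|` makes them
  -- disjoint, as `|A| ≠ 0`.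
  have h1 := (hD.append (definableSet_zero (t := t))).append (definableSet_zero (t := 1))
  have h2 := ((definableSet_zero (t := s)).append hD').append (definableSet_last (t := 1))
  refine ⟨s + t + 1, _, h1.union h2, fun 𝔄 hA v => ?_⟩
  simp only [hf 𝔄 hA, hg 𝔄 hA]
  rw [Set.ncard_union_eq]
  · rw [ncard_appendSet, ncard_appendSet, ncard_appendSet, ncard_appendSet]
    simp
  · rw [Set.disjoint_left]
    rintro a ⟨-, ha⟩ ⟨-, ha'⟩
    have := congrFun (ha.symm.trans ha') 0
    have := congrArg Fin.val this
    simp at this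
    omega

/-- A number is the cardinality of the set of its predecessors. -/
theorem digit {x : (𝔄 : FinStr S) → Assignment Γ 𝔄.Dom → Num 𝔄.Dom}
    (hx : IsVar (s := Srt.number) x) : DefinableNat fun 𝔄 v => (x 𝔄 v : ℕ) := by
  refine ⟨1, fun 𝔄 v => {y | y 0 < x 𝔄 v},
    Definable.lt (isVar_new (T := Ty.num 1) 0) hx.old, fun 𝔄 _ v => ?_⟩
  have : {y : Fin 1 → Num 𝔄.Dom | y 0 < x 𝔄 v} =
      (Equiv.funUnique (Fin 1) (Num 𝔄.Dom)).symm '' Set.Iio (x 𝔄 v) := by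
    ext y
    rw [Set.mem_image_equiv]
    rfl
  refine Eq.trans ?_ (congrArg Set.ncard this).symm
  rw [Set.ncard_image_of_injective _ (Equiv.injective _), Set.ncard_eq_toFinset_card']
  simp

theorem card : DefinableNat (S := S) (Γ := Γ) fun 𝔄 _ => Fintype.card 𝔄.Dom := by
  refine ⟨1, fun 𝔄 v => {y | ∀ i, (y i : ℕ) < Fintype.card 𝔄.Dom},
    Definable.digits, fun 𝔄 _ v => ?_⟩
  have : {y : Fin 1 → Num 𝔄.Dom | ∀ i, (y i : ℕ) < Fintype.card 𝔄.Dom} =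
      (Equiv.funUnique (Fin 1) (Num 𝔄.Dom)).symm '' Set.Iio (Fin.last _) := by
    ext y
    rw [Set.mem_image_equiv, Set.mem_ofPred_eq, Fin.forall_fin_one]
    rfl
  refine Eq.trans ?_ (congrArg Set.ncard this).symm
  rw [Set.ncard_image_of_injective _ (Equiv.injective _), Set.ncard_eq_toFinset_card']
  simp

theorem pow (hf : DefinableNat f) (n : ℕ) : DefinableNat fun 𝔄 v => f 𝔄 v ^ n := by
  induction n with
  | zero => exact one.congr fun _ _ _ => pow_zero _
  | succ n ih => exact (ih.mul hf).congr fun _ _ _ => pow_succ _ _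

theorem sum_fin {n : ℕ} {f : Fin n → (𝔄 : FinStr S) → Assignment Γ 𝔄.Dom → ℕ}
    (hf : ∀ i, DefinableNat (f i)) : DefinableNat fun 𝔄 v => ∑ i, f i 𝔄 v := by
  induction n with
  | zero => exact zero.congr fun _ _ _ => by simp
  | succ n ih =>
    exact ((hf 0).add (ih fun i => hf i.succ)).congr fun _ _ _ => Fin.sum_univ_succ _

theorem numVal {k : ℕ} {x : (𝔄 : FinStr S) → Assignment Γ 𝔄.Dom → Fin k → Num 𝔄.Dom}
    (hx : IsArgs (T := Ty.num k) x) : DefinableNat fun 𝔄 v => numVal (x 𝔄 v) :=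
  sum_fin fun i => (card.pow _).mul (digit (hx i))

/-- Zero padding on opposite sides brings the two sets to the common length `s + t` without changing
their sizes. -/
theorem eq (hf : DefinableNat f) (hg : DefinableNat g) :
    Definable fun 𝔄 v => f 𝔄 v = g 𝔄 v := by
  obtain ⟨s, D, hD, hf⟩ := hf
  obtain ⟨t, D', hD', hg⟩ := hg
  refine (Definable.ncard_eq_ncard (hD.append (definableSet_zero (t := t)))
    ((definableSet_zero (t := s)).append hD')).congr fun 𝔄 hA v => ?_
  rw [hf 𝔄 hA, hg 𝔄 hA, ncard_appendSet, ncard_appendSet]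
  simp

theorem exists_bound (hf : DefinableNat f) :
    ∃ m, ∀ 𝔄 : FinStr S, 2 ≤ Fintype.card 𝔄.Dom → ∀ v, f 𝔄 v < Fintype.card 𝔄.Dom ^ m := by
  obtain ⟨t, D, -, hf⟩ := hf
  refine ⟨2 * t + 1, fun 𝔄 hA v => ?_⟩
  rw [hf 𝔄 hA]
  calc (D 𝔄 v).ncard ≤ Nat.card (Fin t → Num 𝔄.Dom) := Set.ncard_le_card _
    _ ≤ Fintype.card 𝔄.Dom ^ (2 * t) := by
      rw [Nat.card_eq_fintype_card]
      exact card_tuple_le hA (Ty.num t)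
    _ < _ := Nat.pow_lt_pow_right hA (Nat.lt_succ_self _)

/-- Quantification over numbers that are bounded by a definable number. -/
theorem exists_nat (hg : DefinableNat g) {Q : (𝔄 : FinStr S) → Assignment Γ 𝔄.Dom → ℕ → Prop}
    (hQ : ∀ m, Definable fun 𝔄 (w : Assignment (Γ.bind (Ty.num m)) 𝔄.Dom) =>
      Q 𝔄 w.old (OrderLogic.numVal w.nums))
    (hb : ∀ 𝔄 : FinStr S, 2 ≤ Fintype.card 𝔄.Dom → ∀ v n, Q 𝔄 v n → n ≤ g 𝔄 v) :
    Definable fun 𝔄 v => ∃ n, Q 𝔄 v n := by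
  -- The bound on `g` determines how many digits the quantified tuple needs, so `hQ` must be
  -- available for every length.
  obtain ⟨m, hm⟩ := hg.exists_bound
  refine (Definable.ex (T := Ty.num m) (P := fun 𝔄 v a => Q 𝔄 v
    (OrderLogic.numVal (A := 𝔄.Dom) (k := m) a)) (hQ m)).congr fun 𝔄 hA v => ⟨?_, ?_⟩
  · rintro ⟨n, hn⟩
    obtain ⟨c, -, rfl⟩ := exists_digits ((hb 𝔄 hA v n hn).trans_lt (hm 𝔄 hA v))
    exact ⟨c, hn⟩
  · rintro ⟨a, ha⟩
    exact ⟨_, ha⟩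

theorem le (hf : DefinableNat f) (hg : DefinableNat g) :
    Definable fun 𝔄 v => f 𝔄 v ≤ g 𝔄 v :=
  (hg.exists_nat (Q := fun 𝔄 v n => g 𝔄 v = f 𝔄 v + n)
    (fun m => hg.old.eq (hf.old.add (numVal (isArgs_new (T := Ty.num m)))))
    fun _ _ _ _ h => by omega).congr fun _ _ _ => le_iff_exists_add

theorem lt (hf : DefinableNat f) (hg : DefinableNat g) :
    Definable fun 𝔄 v => f 𝔄 v < g 𝔄 v :=
  (hg.le hf).not.congr fun _ _ _ => not_le.symm

/-- Positivity of the divisor bounds the quotient by `g`, which makes the quantifier over quotients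
admissible. -/
theorem dvd (hf : DefinableNat f) (hg : DefinableNat g) :
    Definable fun 𝔄 v => 0 < f 𝔄 v ∧ f 𝔄 v ∣ g 𝔄 v := by
  have := hg.exists_nat (Q := fun 𝔄 v n => 0 < f 𝔄 v ∧ g 𝔄 v = f 𝔄 v * n)
    (fun m => (zero.lt hf.old).and
      (hg.old.eq (hf.old.mul (numVal (isArgs_new (T := Ty.num m))))))
    fun _ _ _ _ h => by rw [h.2]; exact Nat.le_mul_of_pos_left _ h.1
  exact this.congr fun _ _ _ => by rw [exists_and_left]; exact Iff.rfl

/-- Congruence means that the larger number minus the smaller is divisible by `p`. To avoid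
truncated subtraction, the difference is quantified, once for each order of `f` and `g`. -/
theorem modEq {p : (𝔄 : FinStr S) → Assignment Γ 𝔄.Dom → ℕ} (hf : DefinableNat f)
    (hg : DefinableNat g) (hp : DefinableNat p) :
    Definable fun 𝔄 v => 0 < p 𝔄 v ∧ f 𝔄 v ≡ g 𝔄 v [MOD p 𝔄 v] := by
  have key : ∀ {f g : (𝔄 : FinStr S) → Assignment Γ 𝔄.Dom → ℕ}, DefinableNat f → DefinableNat g →
      Definable fun 𝔄 v => ∃ n, f 𝔄 v + n = g 𝔄 v ∧ 0 < p 𝔄 v ∧ p 𝔄 v ∣ n := fun hf hg =>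
    hg.exists_nat (Q := fun 𝔄 v n => _ ∧ 0 < p 𝔄 v ∧ p 𝔄 v ∣ n)
      (fun m => ((hf.old.add (numVal (isArgs_new (T := Ty.num m)))).eq hg.old).and
        (hp.old.dvd (numVal (isArgs_new (T := Ty.num m)))))
      fun _ _ _ _ h => by omega
  refine ((key hf hg).or (key hg hf)).congr fun 𝔄 _ v => ?_
  constructor
  · rintro ⟨h0, h⟩
    rcases le_total (f 𝔄 v) (g 𝔄 v) with hle | hle
    · exact Or.inl ⟨g 𝔄 v - f 𝔄 v, by omega, h0, (Nat.modEq_iff_dvd' hle).1 h⟩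
    · exact Or.inr ⟨f 𝔄 v - g 𝔄 v, by omega, h0, (Nat.modEq_iff_dvd' hle).1 h.symm⟩
  · rintro (⟨n, h, h0, hn⟩ | ⟨n, h, h0, hn⟩)
    · exact ⟨h0, h ▸ (Nat.modEq_iff_dvd' (Nat.le_add_right _ _)).2 (by simpa using hn)⟩
    · exact ⟨h0, (h ▸ (Nat.modEq_iff_dvd' (Nat.le_add_right _ _)).2 (by simpa using hn) :
        g 𝔄 v ≡ f 𝔄 v [MOD p 𝔄 v]).symm⟩

theorem prime (hf : DefinableNat f) : Definable fun 𝔄 v => (f 𝔄 v).Prime := by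
  have h := hf.exists_nat (Q := fun 𝔄 v n => (1 < n ∧ n < f 𝔄 v) ∧ (0 < n ∧ n ∣ f 𝔄 v))
    (fun m => ((one.lt (numVal (isArgs_new (T := Ty.num m)))).and
      ((numVal (isArgs_new (T := Ty.num m))).lt hf.old)).and
        ((numVal (isArgs_new (T := Ty.num m))).dvd hf.old))
    fun _ _ _ _ h => h.1.2.le
  refine ((one.lt hf).and h.not).congr fun 𝔄 _ v => ?_
  rw [Nat.prime_def_lt]
  refine and_congr_right fun h1 => ⟨?_, ?_⟩
  · rintro h2 ⟨n, ⟨h3, h4⟩, -, h5⟩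
    exact h3.ne' (h2 n h4 h5)
  · intro h2 n h3 h4
    by_contra h5
    have := Nat.pos_of_dvd_of_pos h4 (by omega)
    exact h2 ⟨n, ⟨by omega, h3⟩, this, h4⟩

end DefinableNat

theorem Definable.isCode {k : ℕ} {p : (𝔄 : FinStr S) → Assignment Γ 𝔄.Dom → ℕ}
    (hp : DefinableNat p) : Definable fun 𝔄 (w : Assignment (Γ.bind (Ty.num k)) 𝔄.Dom) =>
      IsCode (p 𝔄 w.old) w.nums :=
  digits.and ((DefinableNat.numVal (isArgs_new (T := Ty.num k))).lt hp.old)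

end

/-! ### Definability of the rank -/

/-- The matrix defined by `R`: the least number denoted by a tuple `c` with `R a b c`. -/
noncomputable def leastEntry {A I J : Type} [Fintype A] {k : ℕ}
    (R : I → J → (Fin k → Num A) → Prop) (a : I) (b : J) : ℕ :=
  sInf {m | ∃ c, numVal c = m ∧ R a b c}

section

variable {A I J : Type} [Fintype A] {k : ℕ} {R : I → J → (Fin k → Num A) → Prop}

/-- The second alternative is the default value `sInf ∅ = 0`. It keeps `leastEntry` a definable
matrix even where `R` defines none. -/
theorem numVal_eq_leastEntry_iff (a : I) (b : J) (c : Fin k → Num A) :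
    numVal c = leastEntry R a b ↔ ((∃ d, R a b d ∧ numVal d = numVal c) ∧
      ∀ d, R a b d → numVal c ≤ numVal d) ∨ ((∀ d, ¬ R a b d) ∧ numVal c = 0) := by
  by_cases h : ∃ d, R a b d
  · have hne : {m | ∃ c, numVal c = m ∧ R a b c}.Nonempty :=
      h.elim fun d hd => ⟨_, d, rfl, hd⟩
    have h0 : ¬ ∀ d, ¬ R a b d := fun h' => h.elim h'
    simp only [h0, false_and, or_false]
    constructor
    · intro e
      obtain ⟨d, hd, hR⟩ := Nat.sInf_mem hne
      exact ⟨⟨d, hR, hd.trans e.symm⟩, fun d hd => e ▸ Nat.sInf_le ⟨d, rfl, hd⟩⟩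
    · rintro ⟨⟨d, hd, e⟩, h⟩
      refine le_antisymm (le_csInf hne ?_) (e ▸ Nat.sInf_le ⟨d, rfl, hd⟩)
      rintro _ ⟨d, rfl, hd⟩
      exact h d hd
  · have h0 : ∀ d, ¬ R a b d := fun d hd => h ⟨d, hd⟩
    simp [leastEntry, h0]

/-- Hence a formula can speak of an entry by quantifying over `k`-tuples of numbers. -/
theorem exists_numVal_eq_leastEntry (a : I) (b : J) :
    ∃ c : Fin k → Num A, numVal c = leastEntry R a b := by
  by_cases h : ∃ d, R a b d
  · obtain ⟨d, hd⟩ := h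
    obtain ⟨c, hc, -⟩ := Nat.sInf_mem (s := {m | ∃ c, numVal c = m ∧ R a b c}) ⟨_, d, rfl, hd⟩
    exact ⟨c, hc⟩
  · have : {m | ∃ c, numVal c = m ∧ R a b c} = ∅ :=
      Set.eq_empty_iff_forall_notMem.2 fun m ⟨c, _, hc⟩ => h ⟨c, hc⟩
    exact ⟨fun _ => 0, by rw [leastEntry, this, Nat.sInf_empty]; simp [numVal]⟩

/-- The quantifier over matrices is not first-order. If `R` defines a matrix at all, it is
`leastEntry R`, so the quantifier can be replaced by a first-order check together with this explicit
matrix. -/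
theorem exists_definesMatrix_iff {Q : (I → J → ℕ) → Prop} :
    (∃ M : I → J → ℕ, DefinesMatrix (fun a b m => ∃ c, numVal c = m ∧ R a b c) M ∧ Q M) ↔
      (∀ a b, (∃ c, R a b c) ∧ ∀ c d, R a b c → R a b d → numVal c = numVal d) ∧
        Q (leastEntry R) := by
  constructor
  · rintro ⟨M, hM, hQ⟩
    have hl : leastEntry R = M := by
      funext a b
      have : {m | ∃ c, numVal c = m ∧ R a b c} = {M a b} := Set.ext fun m => hM a b m
      rw [leastEntry, this, csInf_singleton]
    refine ⟨fun a b => ⟨?_, fun c d hc hd => ?_⟩, hl ▸ hQ⟩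
    · obtain ⟨c, -, hc⟩ := (hM a b _).2 rfl
      exact ⟨c, hc⟩
    · rw [(hM a b _).1 ⟨c, rfl, hc⟩, (hM a b _).1 ⟨d, rfl, hd⟩]
  · rintro ⟨h, hQ⟩
    refine ⟨_, fun a b m => ?_, hQ⟩
    obtain ⟨⟨c, hc⟩, hu⟩ := h a b
    have : {m | ∃ c, numVal c = m ∧ R a b c} = {numVal c} := by
      ext m
      constructor
      · rintro ⟨d, rfl, hd⟩
        exact hu d c hd hc
      · rintro rfl
        exact ⟨c, rfl, hc⟩
    rw [leastEntry, this, csInf_singleton]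
    exact Set.ext_iff.1 this m

end

/-! ### Definability of the rank operator and translation of formulas. -/

section

variable {S : Signature} {Γ : Ctx}

/-- The formula that says that the domain has at least two elements. -/
def nontrivialFormula (S : Signature) (L : Set Operator) (Γ : Ctx) : Formula S L Γ :=
  .ex ⟨2, fun _ => Srt.element⟩ (.not (.eq (s := Srt.element) ⟨Sum.inr 0, rfl⟩ ⟨Sum.inr 1, rfl⟩))

theorem nontrivialFormula_holds {L : Set Operator} (𝔄 : FinStr S) (v : Assignment Γ 𝔄.Dom) :
    (nontrivialFormula S L Γ).Holds 𝔄 v ↔ 2 ≤ Fintype.card 𝔄.Dom := by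
  rw [Nat.succ_le_iff, Fintype.one_lt_card_iff]
  constructor
  · rintro ⟨a, ha⟩
    exact ⟨a 0, a 1, ha⟩
  · rintro ⟨x, y, h⟩
    refine ⟨fun i => if i = 0 then x else y, fun h' => h ?_⟩
    exact h'

namespace Definable

variable {X Y : Ty} {k : ℕ}
  {R : (𝔄 : FinStr S) → Assignment Γ 𝔄.Dom → Tuple 𝔄.Dom X → Tuple 𝔄.Dom Y →
    (Fin k → Num 𝔄.Dom) → Prop}

theorem numVal_eq_leastEntry
    (hR : Definable fun 𝔄 (w : Assignment (((Γ.bind X).bind Y).bind (Ty.num k)) 𝔄.Dom) =>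
      R 𝔄 w.old.old.old w.old.old.new w.old.new w.nums) :
    Definable fun 𝔄 (w : Assignment (((Γ.bind X).bind Y).bind (Ty.num k)) 𝔄.Dom) =>
      numVal w.nums = leastEntry (R 𝔄 w.old.old.old) w.old.old.new w.old.new := by
  have n1 := DefinableNat.numVal (isArgs_new (S := S)
    (Γ := (((Γ.bind X).bind Y).bind (Ty.num k))) (T := Ty.num k))
  have n0 := DefinableNat.numVal (isArgs_new (S := S) (Γ := ((Γ.bind X).bind Y)) (T := Ty.num k))
  have hR' := hR.comp (((isPull_id (S := S) (Γ := ((Γ.bind X).bind Y))).old (T := Ty.num k)).old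
    (T := Ty.num k) |>.bind (isArgs_new (S := S)
      (Γ := (((Γ.bind X).bind Y).bind (Ty.num k))) (T := Ty.num k)))
  have h1 := ex (T := Ty.num k) (P := fun 𝔄
    (w : Assignment (((Γ.bind X).bind Y).bind (Ty.num k)) 𝔄.Dom) d =>
    R 𝔄 w.old.old.old w.old.old.new w.old.new d ∧ numVal (A := 𝔄.Dom) (k := k) d = numVal w.nums)
    (hR'.and (n1.eq n0.old))
  have h2 := all (T := Ty.num k) (P := fun 𝔄
    (w : Assignment (((Γ.bind X).bind Y).bind (Ty.num k)) 𝔄.Dom) d =>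
    R 𝔄 w.old.old.old w.old.old.new w.old.new d → numVal w.nums ≤ numVal (A := 𝔄.Dom) (k := k) d)
    (hR'.imp (n0.old.le n1))
  have h3 := all (T := Ty.num k) (P := fun 𝔄
    (w : Assignment (((Γ.bind X).bind Y).bind (Ty.num k)) 𝔄.Dom) d =>
    ¬ R 𝔄 w.old.old.old w.old.old.new w.old.new d) hR'.not
  exact ((h1.and h2).or (h3.and (n0.eq DefinableNat.zero))).congr
    fun 𝔄 _ w => numVal_eq_leastEntry_iff _ _ _

theorem shiftRel_leastEntry {T Z : Ty} (E : TupleSplit T Y Z k)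
    {p : (𝔄 : FinStr S) → Assignment Γ 𝔄.Dom → ℕ} (hp : DefinableNat p)
    (hR : Definable fun 𝔄 (w : Assignment (((Γ.bind X).bind Y).bind (Ty.num k)) 𝔄.Dom) =>
      R 𝔄 w.old.old.old w.old.old.new w.old.new w.nums) :
    Definable fun 𝔄 (w : Assignment (((Γ.bind X).bind T).bind T) 𝔄.Dom) =>
      OrderLogic.shiftRel (E.equiv 𝔄.Dom) (p 𝔄 w.old.old.old) (leastEntry (R 𝔄 w.old.old.old))
        w.old.old.new w.old.new w.new := by
  refine shiftRel E (M := fun 𝔄 v => leastEntry (R 𝔄 v)) (isCode hp) ?_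
  let Δ := (((Γ.bind X).bind Y).bind (Ty.num k)).bind (Ty.num k)
  have c1 := isCode (k := k) (hp.old (T := X) |>.old (T := Y) |>.old (T := Ty.num k))
  have c0 := (isCode (k := k) (hp.old (T := X) |>.old (T := Y))).old (T := Ty.num k)
  have hG : IsPull (S := S) fun 𝔄 (w : Assignment (Δ.bind (Ty.num k)) 𝔄.Dom) => w.old.old.old :=
    ((isPull_id (S := S) (Γ := ((Γ.bind X).bind Y))).old (T := Ty.num k)).old
      (T := Ty.num k) |>.old (T := Ty.num k)
  have hm := (numVal_eq_leastEntry hR).comp (hG.bind (isArgs_new (S := S) (Γ := Δ)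
    (T := Ty.num k)))
  have n2 := DefinableNat.numVal (isArgs_new (S := S) (Γ := Δ) (T := Ty.num k))
  have n1 := (DefinableNat.numVal (isArgs_new (S := S)
    (Γ := ((Γ.bind X).bind Y).bind (Ty.num k)) (T := Ty.num k))).old (T := Ty.num k)
  have n0 := (DefinableNat.numVal (isArgs_new (S := S)
    (Γ := (Γ.bind X).bind Y) (T := Ty.num k))).old (T := Ty.num k) |>.old (T := Ty.num k)
  have hp' := hp.old (T := X) |>.old (T := Y) |>.old (T := Ty.num k) |>.old (T := Ty.num k)
    |>.old (T := Ty.num k)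
  have h := ex (T := Ty.num k) (P := fun 𝔄 (w : Assignment Δ 𝔄.Dom) d =>
    numVal (A := 𝔄.Dom) (k := k) d = leastEntry (R 𝔄 w.old.old.old.old) w.old.old.old.new
      w.old.old.new ∧ 0 < p 𝔄 w.old.old.old.old ∧ numVal w.nums ≡ numVal w.old.nums +
        numVal (A := 𝔄.Dom) (k := k) d [MOD p 𝔄 w.old.old.old.old])
    (hm.and (n1.modEq (n0.add n2) hp'))
  refine (c0.and (c1.and h)).congr fun 𝔄 _ w => ?_
  refine and_congr_right fun hc => and_congr_right fun _ => ⟨fun hw => ?_, ?_⟩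
  · obtain ⟨d, hd⟩ := exists_numVal_eq_leastEntry (R := R 𝔄 w.old.old.old.old) w.old.old.old.new
      w.old.old.new
    exact ⟨d, hd, (Nat.zero_le _).trans_lt hc.2, hd ▸ hw⟩
  · rintro ⟨d, hd, -, hw⟩
    exact hd ▸ hw

/-- The entries are `0` or `1`, so the congruence splits into two cases that involve only definable
numbers. -/
theorem shiftRel_diagMatrix {T Z : Ty} {t : ℕ} (E : TupleSplit T (Ty.num t) Z k)
    {p : (𝔄 : FinStr S) → Assignment Γ 𝔄.Dom → ℕ} (hp : DefinableNat p)
    {D : (𝔄 : FinStr S) → Assignment Γ 𝔄.Dom → Set (Fin t → Num 𝔄.Dom)} (hD : DefinableSet D) :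
    Definable fun 𝔄 (w : Assignment (((Γ.bind (Ty.num t)).bind T).bind T) 𝔄.Dom) =>
      OrderLogic.shiftRel (E.equiv 𝔄.Dom) (p 𝔄 w.old.old.old) (diagMatrix (D 𝔄 w.old.old.old))
        w.old.old.new w.old.new w.new := by
  refine shiftRel E (M := fun 𝔄 v => diagMatrix (D 𝔄 v)) (isCode hp) ?_
  have c1 := isCode (k := k) (hp.old (T := Ty.num t) |>.old (T := Ty.num t) |>.old (T := Ty.num k))
  have c0 := (isCode (k := k) (hp.old (T := Ty.num t) |>.old (T := Ty.num t))).old (T := Ty.num k)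
  have n1 := (DefinableNat.numVal (isArgs_new (S := S)
    (Γ := ((Γ.bind (Ty.num t)).bind (Ty.num t)).bind (Ty.num k)) (T := Ty.num k)))
  have n0 := (DefinableNat.numVal (isArgs_new (S := S)
    (Γ := (Γ.bind (Ty.num t)).bind (Ty.num t)) (T := Ty.num k))).old (T := Ty.num k)
  have hp' := hp.old (T := Ty.num t) |>.old (T := Ty.num t) |>.old (T := Ty.num k)
    |>.old (T := Ty.num k)
  have a2 := ((isArgs_new (S := S) (Γ := (Γ.bind (Ty.num t)))
    (T := Ty.num t)).old (T := Ty.num k)).old (T := Ty.num k)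
  have a3 := (((isArgs_new (S := S) (Γ := Γ)
    (T := Ty.num t)).old (T := Ty.num t)).old (T := Ty.num k)).old (T := Ty.num k)
  have hD' := Definable.comp hD ((((((isPull_id (S := S) (Γ := Γ)).old (T := Ty.num t)).old
    (T := Ty.num t)).old (T := Ty.num k)).old (T := Ty.num k)).bind a3)
  have hd := (eq_tuple a3 a2).and hD'
  refine (c0.and (c1.and ((hd.and (n1.modEq (n0.add DefinableNat.one) hp')).or
    (hd.not.and (n1.modEq n0 hp'))))).congr fun 𝔄 _ w => ?_
  refine and_congr_right fun hc => and_congr_right fun _ => ?_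
  have h0 := (Nat.zero_le _).trans_lt hc.2
  by_cases h : w.old.old.old.new = w.old.old.new ∧ w.old.old.old.nums ∈ D 𝔄 w.old.old.old.old
  · have e : diagMatrix (D 𝔄 w.old.old.old.old) w.old.old.old.nums w.old.old.nums = 1 := if_pos h
    refine ⟨fun hw => Or.inl ⟨h, h0, e ▸ hw⟩, ?_⟩
    rintro (⟨-, -, hw⟩ | ⟨h', -⟩)
    · exact e.symm ▸ hw
    · exact absurd h h'
  · have e : diagMatrix (D 𝔄 w.old.old.old.old) w.old.old.old.nums w.old.old.nums = 0 := if_neg h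
    refine ⟨fun hw => Or.inr ⟨h, h0, ?_⟩, ?_⟩
    · change _ ≡ _ + diagMatrix (D 𝔄 w.old.old.old.old) w.old.old.old.nums w.old.old.nums [MOD _]
        at hw
      rwa [e] at hw
    · rintro (⟨h', -⟩ | ⟨-, -, hw⟩)
      · exact absurd h' h
      · change _ ≡ _ + diagMatrix (D 𝔄 w.old.old.old.old) w.old.old.old.nums w.old.old.nums [MOD _]
        rwa [e]

/-- With `f = |D|`, the equation says that the given matrix and the diagonal matrix of `D` have the
same rank, which is tested by comparing group orders. -/
theorem rankMod_eq {p f : (𝔄 : FinStr S) → Assignment Γ 𝔄.Dom → ℕ} (hp : DefinableNat p)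
    (hf : DefinableNat f)
    (hR : Definable fun 𝔄 (w : Assignment (((Γ.bind X).bind Y).bind (Ty.num k)) 𝔄.Dom) =>
      R 𝔄 w.old.old.old w.old.old.new w.old.new w.nums) :
    Definable fun 𝔄 v => (p 𝔄 v < Fintype.card 𝔄.Dom ^ k ∧ (p 𝔄 v).Prime) ∧
      f 𝔄 v = rankMod (p 𝔄 v) (leastEntry (R 𝔄 v)) := by
  obtain ⟨t, D, hD, hf⟩ := hf
  -- One tuple type serves both groups: the given matrix acts along `Y` with the `t` numbers idle,
  -- and after `swap` the diagonal matrix acts along the `t` numbers with `Y` idle.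
  let E := TupleSplit.block Y t k
  refine (((hp.lt (DefinableNat.card.pow k)).and hp.prime).and (ordRel_eq
    (R := fun 𝔄 v => OrderLogic.shiftRel (E.equiv 𝔄.Dom) (p 𝔄 v) (leastEntry (R 𝔄 v)))
    (R' := fun 𝔄 v => OrderLogic.shiftRel (E.swap.equiv 𝔄.Dom) (p 𝔄 v) (diagMatrix (D 𝔄 v)))
    (U := X) (U' := Ty.num t) (shiftRel_leastEntry E hp hR)
    (shiftRel_diagMatrix E.swap hp hD))).congr fun 𝔄 hA v => ?_
  refine and_congr_right fun h => ?_
  have : Fact (p 𝔄 v).Prime := ⟨h.2⟩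
  rw [hf 𝔄 hA, ← rankMod_diagMatrix (p := p 𝔄 v), eq_comm]
  refine (ordRel_shiftRel_eq_iff hA h.1.le E E.swap ?_ ?_ (U := X) (U' := Ty.num t)
    (leastEntry (R 𝔄 v)) (diagMatrix (D 𝔄 v))).symm <;> simp only [Ty.block] <;> omega

theorem rkRel {l : ℕ} {π : (𝔄 : FinStr S) → Assignment Γ 𝔄.Dom → Fin k → Num 𝔄.Dom}
    {ν : (𝔄 : FinStr S) → Assignment Γ 𝔄.Dom → Fin l → Num 𝔄.Dom}
    (hπ : IsArgs (T := Ty.num k) π) (hν : IsArgs (T := Ty.num l) ν)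
    (hR : Definable fun 𝔄 (w : Assignment (((Γ.bind X).bind Y).bind (Ty.num k)) 𝔄.Dom) =>
      R 𝔄 w.old.old.old w.old.old.new w.old.new w.nums) :
    Definable fun 𝔄 v => ν 𝔄 v ∈ OrderLogic.rkRel l (R 𝔄 v) (π 𝔄 v) := by
  have h1 := rankMod_eq (DefinableNat.numVal hπ) (DefinableNat.numVal hν) hR
  have h2 : Definable fun 𝔄 v => ∀ i : Fin l, 0 < (i : ℕ) →
      (ν 𝔄 v i : ℕ) < Fintype.card 𝔄.Dom :=
    -- The condition `0 < i` concerns the position only, so it is decided when the formula is built.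
    forall_fin fun i => (const _).imp ((DefinableNat.digit (hν i)).lt DefinableNat.card)
  have hR' := hR.comp (((isPull_id (S := S) (Γ := ((Γ.bind X).bind Y))).old (T := Ty.num k)).old
    (T := Ty.num k) |>.bind (isArgs_new (S := S)
      (Γ := (((Γ.bind X).bind Y).bind (Ty.num k))) (T := Ty.num k)))
  have n1 := DefinableNat.numVal (isArgs_new (S := S)
    (Γ := (((Γ.bind X).bind Y).bind (Ty.num k))) (T := Ty.num k))
  have n0 := (DefinableNat.numVal (isArgs_new (S := S) (Γ := ((Γ.bind X).bind Y))
    (T := Ty.num k))).old (T := Ty.num k)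
  have h4 := all (T := Ty.num k) (P := fun 𝔄
    (w : Assignment (((Γ.bind X).bind Y).bind (Ty.num k)) 𝔄.Dom) d =>
    R 𝔄 w.old.old.old w.old.old.new w.old.new w.nums → R 𝔄 w.old.old.old w.old.old.new w.old.new d →
      numVal w.nums = numVal (A := 𝔄.Dom) (k := k) d)
    (hR.old.imp (hR'.imp (n0.eq n1)))
  have h5 := all (T := Ty.num k) (P := fun 𝔄
    (w : Assignment ((Γ.bind X).bind Y) 𝔄.Dom) (c : Fin k → Num 𝔄.Dom) =>
    ∀ d : Fin k → Num 𝔄.Dom, R 𝔄 w.old.old w.old.new w.new c → R 𝔄 w.old.old w.old.new w.new d →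
      numVal c = numVal d) h4
  have h6 := ex (T := Ty.num k) (P := fun 𝔄
    (w : Assignment ((Γ.bind X).bind Y) 𝔄.Dom) (c : Fin k → Num 𝔄.Dom) =>
    R 𝔄 w.old.old w.old.new w.new c) hR
  have h7 := all (T := Y) (P := fun 𝔄
    (w : Assignment (Γ.bind X) 𝔄.Dom) b => (∃ c : Fin k → Num 𝔄.Dom, R 𝔄 w.old w.new b c) ∧
    ∀ c d : Fin k → Num 𝔄.Dom, R 𝔄 w.old w.new b c → R 𝔄 w.old w.new b d →
      numVal c = numVal d) (h6.and h5)
  have h8 := all (T := X) (P := fun 𝔄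
    (v : Assignment Γ 𝔄.Dom) a => ∀ b, (∃ c : Fin k → Num 𝔄.Dom, R 𝔄 v a b c) ∧
    ∀ c d : Fin k → Num 𝔄.Dom, R 𝔄 v a b c → R 𝔄 v a b d →
      numVal c = numVal d) h7
  refine (h1.and (h8.and h2)).congr fun 𝔄 _ v => ?_
  simp only [OrderLogic.rkRel, Set.mem_ofPred_eq, exists_definesMatrix_iff, Encodes]
  tauto

end Definable

/-- Every instance of the rank operator is definable in `FP + ord`. -/
theorem exists_formula_rkRel {X Y : Ty} {k l : ℕ}
    (φ : Formula S FPord (((Γ.bind X).bind Y).bind (Ty.num k))) (π : Γ.Args (Ty.num k)) :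
    ∃ ψ : Formula S FPord (Γ.bind (Ty.num l)),
      ∀ (𝔄 : FinStr S) (v : Assignment Γ 𝔄.Dom) (ν : Fin l → Num 𝔄.Dom),
        ψ.Holds 𝔄 (v.bind (T := Ty.num l) ν) ↔ ν ∈ rkRel l
          (fun a b c => φ.Holds 𝔄 (((v.bind a).bind b).bind (T := Ty.num k) c)) (v.gets π) := by
  have hφ := (Definable.of_formula φ).comp (((((isPull_id (S := S) (Γ := Γ)).old
    (T := Ty.num l)).old (T := X)).old (T := Y)).old (T := Ty.num k) |>.bind
      (((isArgs_new (S := S) (T := X)).old (T := Y)).old (T := Ty.num k)) |>.bind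
      ((isArgs_new (S := S) (T := Y)).old (T := Ty.num k)) |>.bind
      (isArgs_new (S := S) (T := Ty.num k)))
  obtain ⟨ψ, hψ⟩ := Definable.rkRel (Γ := Γ.bind (Ty.num l)) (X := X) (Y := Y) (k := k) (l := l)
    (R := fun 𝔄 w a b c => φ.Holds 𝔄 (((w.old.bind a).bind b).bind (T := Ty.num k) c))
    ((isArgs_gets (S := S) π).old (T := Ty.num l)) (isArgs_new (S := S) (T := Ty.num l)) hφ
  -- The formula `ψ` is only controlled on domains with at least two elements; on smaller ones the
  -- conjunction is false, in agreement with the empty rank relation.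
  refine ⟨.and (nontrivialFormula S FPord _) ψ, fun 𝔄 v ν => ?_⟩
  have hN : Formula.Holds 𝔄 (.and (nontrivialFormula S FPord _) ψ) (v.bind (T := Ty.num l) ν) ↔
      2 ≤ Fintype.card 𝔄.Dom ∧ ψ.Holds 𝔄 (v.bind (T := Ty.num l) ν) := by
    rw [← nontrivialFormula_holds 𝔄 (v.bind (T := Ty.num l) ν)]
    exact Iff.rfl
  rw [hN]
  constructor
  · rintro ⟨hA, h⟩
    exact (hψ 𝔄 hA _).1 h
  · intro h
    have hA : 2 ≤ Fintype.card 𝔄.Dom := by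
      by_contra hA
      have h1 : Fintype.card 𝔄.Dom ^ k ≤ 1 := pow_le_one₀ (Nat.zero_le _) (by omega)
      have h2 := h.2.1.two_le
      have h3 : _ < Fintype.card 𝔄.Dom ^ k := h.1
      omega
    exact ⟨hA, (hψ 𝔄 hA _).2 h⟩

/-- Every formula of `FP + rk` is equivalent to a formula of `FP + ord`. -/
theorem Formula.exists_ord_formula (φ : Formula S FPrk Γ) :
    ∃ ψ : Formula S FPord Γ, ∀ (𝔄 : FinStr S) (v : Assignment Γ 𝔄.Dom),
      ψ.Holds 𝔄 v ↔ φ.Holds 𝔄 v := by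
  induction φ with
  | eq x y => exact ⟨.eq x y, fun _ _ => Iff.rfl⟩
  | le x y => exact ⟨.le x y, fun _ _ => Iff.rfl⟩
  | rel R x => exact ⟨.rel R x, fun _ _ => Iff.rfl⟩
  | rvar X x => exact ⟨.rvar X x, fun _ _ => Iff.rfl⟩
  | not φ ih =>
    obtain ⟨ψ, h⟩ := ih
    exact ⟨.not ψ, fun 𝔄 v => by simp only [Formula.Holds, h]⟩
  | and φ φ' ih ih' =>
    obtain ⟨ψ, h⟩ := ih
    obtain ⟨ψ', h'⟩ := ih'
    exact ⟨.and ψ ψ', fun 𝔄 v => by simp only [Formula.Holds, h, h']⟩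
  | ex T φ ih =>
    obtain ⟨ψ, h⟩ := ih
    exact ⟨.ex T ψ, fun 𝔄 v => by simp only [Formula.Holds, h]⟩
  | ifp T φ x ih =>
    obtain ⟨ψ, h⟩ := ih
    exact ⟨.ifp T ψ x, fun 𝔄 v => by simp only [Formula.Holds, h]⟩
  | count φ ν ih =>
    obtain ⟨ψ, h⟩ := ih
    exact ⟨.count ψ ν, fun 𝔄 v => by simp only [Formula.Holds, h]⟩
  | ord hL => cases hL
  | @rk Γ hL X Y k l φ π ν ih =>
    obtain ⟨ψ, h⟩ := ih
    obtain ⟨χ, hχ⟩ := exists_formula_rkRel (l := l) ψ π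
    -- The output block of `χ` consists of fresh variables; this renaming substitutes the actual
    -- arguments `ν` for them.
    obtain ⟨ρ, hρ⟩ := (isPull_id (S := S) (Γ := Γ)).bind (isArgs_gets (S := S) ν)
    obtain ⟨χ', hχ'⟩ := χ.exists_rename ρ
    refine ⟨χ', fun 𝔄 v => ?_⟩
    refine (hχ' 𝔄 v).trans ?_
    rw [← hρ]
    refine (hχ 𝔄 v _).trans ?_
    simp only [Formula.Holds, h]
    exact Iff.rfl

end

end OrderLogic

open OrderLogic
theorem mainTheorem3 :
    (∀ (S : Signature) (Γ : Ctx) (X Y : Ty) (k l : ℕ)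
      (φ : Formula S FPord (((Γ.bind X).bind Y).bind (Ty.num k)))
      (π : Γ.Args (Ty.num k)),
      ∃ ψ : Formula S FPord (Γ.bind (Ty.num l)),
        ∀ (𝔄 : FinStr S) (v : Assignment Γ 𝔄.Dom),
          {ν : Fin l → Num 𝔄.Dom | ψ.Holds 𝔄 (v.bind (T := Ty.num l) ν)} =
            rkRel l
              (fun a b c => φ.Holds 𝔄 (((v.bind a).bind b).bind (T := Ty.num k) c))
              (v.gets π)) ∧
    LogicLE FPrk FPord := by
  constructor
  · intro S Γ X Y k l φ π
    obtain ⟨ψ, hψ⟩ := exists_formula_rkRel (l := l) φ π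
    exact ⟨ψ, fun 𝔄 v => Set.ext fun ν => hψ 𝔄 v ν⟩
  · intro S T φ
    obtain ⟨ψ, hψ⟩ := φ.exists_ord_formula
    exact ⟨ψ, fun 𝔄 => Set.ext fun a => hψ 𝔄 _⟩
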